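/- Let $1<p\le q<\infty$, $\frac1p+\frac1{p'}=1$. Let $H_s^{\pm}\subset L_s(\mathbb R)$ be the Hardy spaces of the upper and lower half-planes, put $\mathcal H_s^{\pm}=(\xi\pm i)H_s^{\pm}$ and $r(\xi)=\frac{\xi-i}{\xi+i}$, and for $n\ge 1$ let $K_{r^n}=\operatorname{span}\{\frac{1}{\xi+i}r^j: 0\le j\le n-1\}$. For $g\in L_\infty(\mathbb R)$ let $T_g$ be the Toeplitz operator on $H_p^+$, $T_gf=P^+(gf)$, with $P^+$ the projection onto $H_p^+$ parallel to $H_p^-$, and let $T_g^*$ be its adjoint on $H_{p'}^+$ with respect to the pairing $\langle f,\psi\rangle=\int_{\mathbb R} f\overline{\psi}$. Suppose that $g\in L_\infty(\mathbb R)$ admits a $(q,p')$-factorization $$g=g_-\,r^k\,g_+,\qquad k\in\mathbb Z,\qquad g_-\in\mathcal H_q^-,\quad g_-^{-1}\in\mathcal H_{p'}^-,\quad g_+\in\mathcal H_{p'}^+,\quad g_+^{-1}\in\mathcal H_q^+ .$$ Then $\ker T_g^*=\ker T_{\bar g}$, where $T_{\bar g}$ acts on $H_{p'}^+$, and: (i)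 If $g_-\in\mathcal H_p^-$ and $g_+^{-1}\in\mathcal H_p^+$, then $\ker T_g^*=\{0\}$ for $k\le 0$, while for $k>0$ we have $\dim\ker T_g^*=k$ and $\ker T_g^*=\overline{g_-^{-1}}\,K_{r^k}$. (ii) If $g_-\notin\mathcal H_p^-$ or $g_+^{-1}\notin\mathcal H_p^+$, then $\dim\ker T_g^*=0$ for $k<0$, and for $k\ge 0$ $$\dim\ker T_g^*=\begin{cases}k, & \text{if } g_-^{-1}\notin H_{p'}^-\ \text{ or }\ g_+\notin H_{p'}^+,\\ k+1, & \text{if } g_-^{-1}\in H_{p'}^-\ \text{ and }\ g_+\in H_{p'}^+ .\end{cases}$$ -/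

import Mathlib

open MeasureTheory Filter Topology Complex
open scoped ENNReal NNReal ComplexConjugate

noncomputable section

/-- `f ∈ H_p^+` for `1 ≤ p < ∞`: the function `f ∈ L_p(ℝ)` is the boundary function of an `F`
in the Hardy space `H^p` of the upper half plane, that is, `F` is holomorphic in `Im z > 0`, its
`L_p` norms along the horizontal lines `Im z = y` are uniformly bounded, and
`F(· + iy) → f` in `L_p(ℝ)` as `y → 0⁺`. -/
def MemHardyPlus (p : ℝ≥0∞) (f : ℝ → ℂ) : Prop :=
  MemLp f p volume ∧ ∃ F : ℂ → ℂ,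
    DifferentiableOn ℂ F {z : ℂ | 0 < z.im} ∧
    (∃ C : ℝ≥0, ∀ y : ℝ, 0 < y →
      eLpNorm (fun x : ℝ => F ((x : ℂ) + (y : ℂ) * I)) p volume ≤ C) ∧
    Tendsto (fun y : ℝ => eLpNorm (fun x : ℝ => F ((x : ℂ) + (y : ℂ) * I) - f x) p volume)
      (𝓝[>] 0) (𝓝 0)

/-- `f ∈ H_p^-` for `1 ≤ p < ∞`: the same for the lower half plane. -/
def MemHardyMinus (p : ℝ≥0∞) (f : ℝ → ℂ) : Prop :=
  MemLp f p volume ∧ ∃ F : ℂ → ℂ,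
    DifferentiableOn ℂ F {z : ℂ | z.im < 0} ∧
    (∃ C : ℝ≥0, ∀ y : ℝ, 0 < y →
      eLpNorm (fun x : ℝ => F ((x : ℂ) - (y : ℂ) * I)) p volume ≤ C) ∧
    Tendsto (fun y : ℝ => eLpNorm (fun x : ℝ => F ((x : ℂ) - (y : ℂ) * I) - f x) p volume)
      (𝓝[>] 0) (𝓝 0)

/-- `f ∈ 𝓗_p^+ = λ_+ H_p^+`, where `λ_+(ξ) = ξ + i`. -/
def MemScriptHardyPlus (p : ℝ≥0∞) (f : ℝ → ℂ) : Prop :=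
  MemHardyPlus p (fun x : ℝ => f x / ((x : ℂ) + I))

/-- `f ∈ 𝓗_p^- = λ_- H_p^-`, where `λ_-(ξ) = ξ - i`. -/
def MemScriptHardyMinus (p : ℝ≥0∞) (f : ℝ → ℂ) : Prop :=
  MemHardyMinus p (fun x : ℝ => f x / ((x : ℂ) - I))

/-- `r(ξ) = (ξ - i) / (ξ + i)`. -/
def rFun (x : ℝ) : ℂ := ((x : ℂ) - I) / ((x : ℂ) + I)

/-- `g = g_- r^k g_+` is a `(j,s)`-factorization of `g` with index `k`. The factors are nonzero
almost everywhere, so that their inverses make sense. -/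
structure IsFactorization (j s : ℝ≥0∞) (g gm gp : ℝ → ℂ) (k : ℤ) : Prop where
  one_lt_j : 1 < j
  j_lt_top : j < ∞
  one_lt_s : 1 < s
  s_lt_top : s < ∞
  inv_add_inv_le : j⁻¹ + s⁻¹ ≤ 1
  eq : ∀ᵐ x : ℝ, g x = gm x * rFun x ^ k * gp x
  gm_ne : ∀ᵐ x : ℝ, gm x ≠ 0
  gp_ne : ∀ᵐ x : ℝ, gp x ≠ 0
  gm_mem : MemScriptHardyMinus j gm
  gm_inv_mem : MemScriptHardyMinus s (fun x => (gm x)⁻¹)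
  gp_mem : MemScriptHardyPlus s gp
  gp_inv_mem : MemScriptHardyPlus j (fun x => (gp x)⁻¹)

/-- `K_{r^n} = span {(ξ + i)⁻¹ r^j : j = 0, …, n - 1}`. -/
def modelSpace (n : ℕ) : Submodule ℂ (ℝ → ℂ) :=
  Submodule.span ℂ
    (Set.range fun (j : Fin n) (x : ℝ) => 1 / ((x : ℂ) + I) * rFun x ^ (j : ℕ))

/-! ### Linearity of the Hardy classes -/

lemma aesm_of_diffOn {F : ℂ → ℂ} {s : Set ℂ} (hF : DifferentiableOn ℂ F s) (φ : ℝ → ℂ)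
    (hφ : Continuous φ) (hs : ∀ x, φ x ∈ s) :
    AEStronglyMeasurable (fun x => F (φ x)) (volume : Measure ℝ) :=
  (hF.continuousOn.comp_continuous hφ hs).aestronglyMeasurable

lemma tendsto_eLpNorm_add {p : ℝ≥0∞} {u v : ℝ → ℝ → ℂ}
    (hu : ∀ y, 0 < y → AEStronglyMeasurable (u y) volume)
    (hv : ∀ y, 0 < y → AEStronglyMeasurable (v y) volume)
    (h1 : Tendsto (fun y => eLpNorm (u y) p volume) (𝓝[>] 0) (𝓝 0))
    (h2 : Tendsto (fun y => eLpNorm (v y) p volume) (𝓝[>] 0) (𝓝 0)) :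
    Tendsto (fun y => eLpNorm (u y + v y) p volume) (𝓝[>] (0 : ℝ)) (𝓝 0) := by
  have h3 : Tendsto (fun y => ENNReal.LpAddConst p * (eLpNorm (u y) p volume + eLpNorm (v y) p volume))
      (𝓝[>] (0 : ℝ)) (𝓝 0) := by
    have := ENNReal.Tendsto.const_mul (a := ENNReal.LpAddConst p) (h1.add h2)
      (Or.inr (ENNReal.LpAddConst_lt_top p).ne)
    simpa using this
  refine tendsto_of_tendsto_of_tendsto_of_le_of_le' tendsto_const_nhds h3
    (Eventually.of_forall fun _ => zero_le) ?_
  filter_upwards [self_mem_nhdsWithin] with y hy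
  exact eLpNorm_add_le' (hu y hy) (hv y hy) p

lemma bdd_eLpNorm_add {p : ℝ≥0∞} {u v : ℝ → ℝ → ℂ}
    (hu : ∀ y, 0 < y → AEStronglyMeasurable (u y) volume)
    (hv : ∀ y, 0 < y → AEStronglyMeasurable (v y) volume)
    (h1 : ∃ C : ℝ≥0, ∀ y : ℝ, 0 < y → eLpNorm (u y) p volume ≤ C)
    (h2 : ∃ C : ℝ≥0, ∀ y : ℝ, 0 < y → eLpNorm (v y) p volume ≤ C) :
    ∃ C : ℝ≥0, ∀ y : ℝ, 0 < y → eLpNorm (u y + v y) p volume ≤ C := by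
  obtain ⟨C, hC⟩ := h1
  obtain ⟨D, hD⟩ := h2
  refine ⟨(ENNReal.LpAddConst p).toNNReal * (C + D), fun y hy => ?_⟩
  push_cast
  rw [ENNReal.coe_toNNReal (ENNReal.LpAddConst_lt_top p).ne]
  exact (eLpNorm_add_le' (hu y hy) (hv y hy) p).trans
    (mul_le_mul_right (add_le_add (hC y hy) (hD y hy)) _)

lemma tendsto_eLpNorm_smul {p : ℝ≥0∞} {u : ℝ → ℝ → ℂ} (c : ℂ)
    (h1 : Tendsto (fun y => eLpNorm (u y) p volume) (𝓝[>] 0) (𝓝 0)) :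
    Tendsto (fun y => eLpNorm (c • u y) p volume) (𝓝[>] (0 : ℝ)) (𝓝 0) := by
  have := ENNReal.Tendsto.const_mul (a := ‖c‖ₑ) h1 (Or.inr enorm_ne_top)
  simpa [eLpNorm_const_smul] using this

lemma bdd_eLpNorm_smul {p : ℝ≥0∞} {u : ℝ → ℝ → ℂ} (c : ℂ)
    (h1 : ∃ C : ℝ≥0, ∀ y : ℝ, 0 < y → eLpNorm (u y) p volume ≤ C) :
    ∃ C : ℝ≥0, ∀ y : ℝ, 0 < y → eLpNorm (c • u y) p volume ≤ C := by
  obtain ⟨C, hC⟩ := h1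
  refine ⟨‖c‖₊ * C, fun y hy => ?_⟩
  rw [eLpNorm_const_smul]
  push_cast
  exact mul_le_mul_right (hC y hy) _

lemma MemHardyPlus.congr {p : ℝ≥0∞} {f g : ℝ → ℂ} (hf : MemHardyPlus p f)
    (h : f =ᵐ[volume] g) : MemHardyPlus p g := by
  obtain ⟨h0, F, hF, hb, ht⟩ := hf
  refine ⟨h0.ae_eq h, F, hF, hb, ht.congr fun y => eLpNorm_congr_ae ?_⟩
  filter_upwards [h] with x hx
  rw [hx]

lemma MemHardyMinus.congr {p : ℝ≥0∞} {f g : ℝ → ℂ} (hf : MemHardyMinus p f)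
    (h : f =ᵐ[volume] g) : MemHardyMinus p g := by
  obtain ⟨h0, F, hF, hb, ht⟩ := hf
  refine ⟨h0.ae_eq h, F, hF, hb, ht.congr fun y => eLpNorm_congr_ae ?_⟩
  filter_upwards [h] with x hx
  rw [hx]

lemma MemHardyPlus.zero (p : ℝ≥0∞) : MemHardyPlus p (fun _ => 0) :=
  ⟨MemLp.zero', fun _ => 0, differentiableOn_const _, ⟨0, by simp⟩, by simp⟩

lemma MemHardyMinus.zero (p : ℝ≥0∞) : MemHardyMinus p (fun _ => 0) :=
  ⟨MemLp.zero', fun _ => 0, differentiableOn_const _, ⟨0, by simp⟩, by simp⟩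

lemma MemHardyPlus.add {p : ℝ≥0∞} {f g : ℝ → ℂ} (hf : MemHardyPlus p f)
    (hg : MemHardyPlus p g) : MemHardyPlus p (fun x => f x + g x) := by
  obtain ⟨h0, F, hF, hb, ht⟩ := hf
  obtain ⟨k0, G, hG, kb, kt⟩ := hg
  have mF : ∀ y : ℝ, 0 < y →
      AEStronglyMeasurable (fun x : ℝ => F ((x : ℂ) + (y : ℂ) * I)) volume := fun y hy =>
    aesm_of_diffOn hF _ (by fun_prop) (by simpa using hy)
  have mG : ∀ y : ℝ, 0 < y →
      AEStronglyMeasurable (fun x : ℝ => G ((x : ℂ) + (y : ℂ) * I)) volume := fun y hy =>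
    aesm_of_diffOn hG _ (by fun_prop) (by simpa using hy)
  refine ⟨h0.add k0, fun z => F z + G z, hF.add hG, bdd_eLpNorm_add mF mG hb kb, ?_⟩
  refine (tendsto_eLpNorm_add (fun y hy => (mF y hy).sub h0.1)
    (fun y hy => (mG y hy).sub k0.1) ht kt).congr fun y => ?_
  congr 1
  ext x
  simp only [Pi.add_apply, Pi.sub_apply]
  ring

lemma MemHardyMinus.add {p : ℝ≥0∞} {f g : ℝ → ℂ} (hf : MemHardyMinus p f)
    (hg : MemHardyMinus p g) : MemHardyMinus p (fun x => f x + g x) := by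
  obtain ⟨h0, F, hF, hb, ht⟩ := hf
  obtain ⟨k0, G, hG, kb, kt⟩ := hg
  have mF : ∀ y : ℝ, 0 < y →
      AEStronglyMeasurable (fun x : ℝ => F ((x : ℂ) - (y : ℂ) * I)) volume := fun y hy =>
    aesm_of_diffOn hF _ (by fun_prop) (by simpa using hy)
  have mG : ∀ y : ℝ, 0 < y →
      AEStronglyMeasurable (fun x : ℝ => G ((x : ℂ) - (y : ℂ) * I)) volume := fun y hy =>
    aesm_of_diffOn hG _ (by fun_prop) (by simpa using hy)
  refine ⟨h0.add k0, fun z => F z + G z, hF.add hG, bdd_eLpNorm_add mF mG hb kb, ?_⟩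
  refine (tendsto_eLpNorm_add (fun y hy => (mF y hy).sub h0.1)
    (fun y hy => (mG y hy).sub k0.1) ht kt).congr fun y => ?_
  congr 1
  ext x
  simp only [Pi.add_apply, Pi.sub_apply]
  ring

lemma MemHardyPlus.const_mul {p : ℝ≥0∞} {f : ℝ → ℂ} (c : ℂ) (hf : MemHardyPlus p f) :
    MemHardyPlus p (fun x => c * f x) := by
  obtain ⟨h0, F, hF, hb, ht⟩ := hf
  refine ⟨h0.const_mul c, fun z => c * F z, hF.const_mul c, bdd_eLpNorm_smul c hb, ?_⟩
  refine (tendsto_eLpNorm_smul c ht).congr fun y => ?_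
  congr 1
  ext x
  simp only [Pi.smul_apply, smul_eq_mul]
  ring

lemma MemHardyMinus.const_mul {p : ℝ≥0∞} {f : ℝ → ℂ} (c : ℂ) (hf : MemHardyMinus p f) :
    MemHardyMinus p (fun x => c * f x) := by
  obtain ⟨h0, F, hF, hb, ht⟩ := hf
  refine ⟨h0.const_mul c, fun z => c * F z, hF.const_mul c, bdd_eLpNorm_smul c hb, ?_⟩
  refine (tendsto_eLpNorm_smul c ht).congr fun y => ?_
  congr 1
  ext x
  simp only [Pi.smul_apply, smul_eq_mul]
  ring

/-! ### Toeplitz operators and their adjoints -/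

/-- The graph of the Toeplitz operator `T_g : f ↦ P⁺(g f)` in `H_p^+`, where `P⁺` is the
projection onto `H_p^+` parallel to `H_p^-`: the pairs `(f, u)` with `f, u ∈ H_p^+` and
`g f - u ∈ H_p^-`. -/
def toeplitzGraph (p : ℝ≥0∞) (g : ℝ → ℂ) :
    Submodule ℂ (Lp ℂ p (volume : Measure ℝ) × Lp ℂ p (volume : Measure ℝ)) where
  carrier := {w | MemHardyPlus p w.1 ∧ MemHardyPlus p w.2 ∧
    MemHardyMinus p (fun x => g x * w.1 x - w.2 x)}
  zero_mem' := by
    have h : ((0 : Lp ℂ p (volume : Measure ℝ)) : ℝ → ℂ) =ᵐ[volume] fun _ => 0 :=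
      Lp.coeFn_zero ℂ p volume
    refine ⟨(MemHardyPlus.zero p).congr h.symm, (MemHardyPlus.zero p).congr h.symm,
      (MemHardyMinus.zero p).congr ?_⟩
    filter_upwards [h] with x hx
    simp only [Prod.fst_zero, Prod.snd_zero, hx]
    ring
  add_mem' := by
    rintro ⟨f, u⟩ ⟨f', u'⟩ ⟨h1, h2, h3⟩ ⟨k1, k2, k3⟩
    have hf := Lp.coeFn_add f f'
    have hu := Lp.coeFn_add u u'
    refine ⟨(h1.add k1).congr hf.symm, (h2.add k2).congr hu.symm, (h3.add k3).congr ?_⟩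
    filter_upwards [hf, hu] with x hx hy
    simp only [Prod.mk_add_mk, hx, hy, Pi.add_apply]
    ring
  smul_mem' := by
    rintro c ⟨f, u⟩ ⟨h1, h2, h3⟩
    have hf := Lp.coeFn_smul c f
    have hu := Lp.coeFn_smul c u
    refine ⟨(h1.const_mul c).congr hf.symm, (h2.const_mul c).congr hu.symm,
      (h3.const_mul c).congr ?_⟩
    filter_upwards [hf, hu] with x hx hy
    simp only [Prod.smul_mk, hx, hy, Pi.smul_apply, smul_eq_mul]
    ring

/-- `ker T_g` for the Toeplitz operator `T_g` in `H_p^+`. -/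
def toeplitzKer (p : ℝ≥0∞) (g : ℝ → ℂ) : Submodule ℂ (Lp ℂ p (volume : Measure ℝ)) :=
  (toeplitzGraph p g).comap (LinearMap.inl ℂ _ _)

lemma integrable_mul_conj {p p' : ℝ≥0∞} [ENNReal.HolderConjugate p p']
    (u : Lp ℂ p (volume : Measure ℝ)) (v : Lp ℂ p' (volume : Measure ℝ)) :
    Integrable (fun x => u x * conj (v x)) volume := by
  have hv : MemLp (fun x => conj (v x)) p' volume := (Lp.memLp v).star
  exact (Lp.memLp u).integrable_mul hv

/-- The graph of the adjoint `T_g^*` of the Toeplitz operator `T_g` in `H_p^+`, as an operator in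
`H_{p'}^+`, with respect to the pairing `⟨f, ψ⟩ = ∫ f ψ̄` of `H_p^+` and `H_{p'}^+`: the pairs
`(ψ, χ)` with `ψ, χ ∈ H_{p'}^+` and `⟨T_g f, ψ⟩ = ⟨f, χ⟩` for all `f`. -/
def toeplitzAdjointGraph (p p' : ℝ≥0∞) [ENNReal.HolderConjugate p p'] (g : ℝ → ℂ) :
    Submodule ℂ (Lp ℂ p' (volume : Measure ℝ) × Lp ℂ p' (volume : Measure ℝ)) where
  carrier := {w | MemHardyPlus p' w.1 ∧ MemHardyPlus p' w.2 ∧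
    ∀ f u : Lp ℂ p (volume : Measure ℝ), (f, u) ∈ toeplitzGraph p g →
      ∫ x, u x * conj (w.1 x) = ∫ x, f x * conj (w.2 x)}
  zero_mem' := by
    have h : ((0 : Lp ℂ p' (volume : Measure ℝ)) : ℝ → ℂ) =ᵐ[volume] fun _ => 0 :=
      Lp.coeFn_zero ℂ p' volume
    refine ⟨(MemHardyPlus.zero p').congr h.symm, (MemHardyPlus.zero p').congr h.symm,
      fun f u _ => ?_⟩
    have key : ∀ a : Lp ℂ p (volume : Measure ℝ),
        ∫ x, a x * conj ((0 : Lp ℂ p' (volume : Measure ℝ)) x) = 0 := fun a => by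
      refine integral_eq_zero_of_ae ?_
      filter_upwards [h] with x hx
      simp
    exact (key u).trans (key f).symm
  add_mem' := by
    rintro ⟨f, u⟩ ⟨f', u'⟩ ⟨h1, h2, h3⟩ ⟨k1, k2, k3⟩
    refine ⟨(h1.add k1).congr (Lp.coeFn_add f f').symm,
      (h2.add k2).congr (Lp.coeFn_add u u').symm, fun a b hab => ?_⟩
    have key : ∀ (a : Lp ℂ p (volume : Measure ℝ)) (v w : Lp ℂ p' (volume : Measure ℝ)),
        ∫ x, a x * conj ((v + w) x) = (∫ x, a x * conj (v x)) + ∫ x, a x * conj (w x) :=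
      fun a v w => by
        rw [← integral_add (integrable_mul_conj a v) (integrable_mul_conj a w)]
        refine integral_congr_ae ?_
        filter_upwards [Lp.coeFn_add v w] with x hx
        rw [hx, Pi.add_apply, map_add, mul_add]
    exact (key b f f').trans
      ((congrArg₂ (· + ·) (h3 a b hab) (k3 a b hab)).trans (key a u u').symm)
  smul_mem' := by
    rintro c ⟨f, u⟩ ⟨h1, h2, h3⟩
    refine ⟨(h1.const_mul c).congr (Lp.coeFn_smul c f).symm,
      (h2.const_mul c).congr (Lp.coeFn_smul c u).symm, fun a b hab => ?_⟩
    have key : ∀ (a : Lp ℂ p (volume : Measure ℝ)) (v : Lp ℂ p' (volume : Measure ℝ)),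
        ∫ x, a x * conj ((c • v) x) = conj c * ∫ x, a x * conj (v x) :=
      fun a v => by
        rw [← integral_const_mul]
        refine integral_congr_ae ?_
        filter_upwards [Lp.coeFn_smul c v] with x hx
        rw [hx, Pi.smul_apply, smul_eq_mul, map_mul]
        ring
    exact (key b f).trans ((congrArg (conj c * ·) (h3 a b hab)).trans (key a u).symm)

/-- `ker T_g^*` for the adjoint of the Toeplitz operator `T_g` in `H_p^+`, a subspace of
`H_{p'}^+`. -/
def toeplitzAdjointKer (p p' : ℝ≥0∞) [ENNReal.HolderConjugate p p'] (g : ℝ → ℂ) :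
    Submodule ℂ (Lp ℂ p' (volume : Measure ℝ)) :=
  (toeplitzAdjointGraph p p' g).comap (LinearMap.inl ℂ _ _)

end

/-!
The kernel of `T_g^*` is that of `T_ḡ`, and the latter is computed from the factorization.

*The adjoint.* Functions of `H_1^±` have integral zero (`MemHardyPlus.integral_eq_zero`), which shows
that `T_ḡ ψ = 0` makes `ψ` orthogonal to the range of `T_g`. For the converse it suffices to know
that the domain of `T_g` contains enough functions, namely `f` such that `g f` decays rapidly. For
such a function `h = g f` the Riesz decomposition `h = u + v` in `L_p` is elementary
(`exists_memHardyPlus_sub_memHardyMinus`): for real `h` with Cauchy integral `U`, the identity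
`∫ U(x + iy)^{2m} dx = 0` bounds the `L_{2m}` norm of `U` by that of its real part, a Poisson integral;
the exponent `p < 2m` is reached by applying this to `(x + i) h` and dividing by `x + i`. Hence, for
`ψ ∈ ker T_g^*`, the function `g ψ̄` has vanishing Cauchy integral in the lower half plane, so that it
belongs to `H_{p'}^+`: its Cauchy integral in the upper half plane is its Poisson integral, which
converges to it in `L_{p'}` (`memHardyPlus_of_integral_eq_zero`).

*The kernel.* For `ψ ∈ ker T_ḡ` the functions `A = g_- ψ̄ / (x - i)²` and
`B = g_+⁻¹ g ψ̄ / (x + i)²` belong to `H_1^-` and `H_1^+`, and `B = r^{k+2} A`. A Liouville theorem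
(`exists_eq_sum_of_eq_rFun_pow_mul`), proved by repeatedly splitting off a pole at `-i`, gives
`B = (c_0 + … + c_k r^k) / (x + i)²`, or `B = 0` for `k < 0`. Thus `ψ = conj (g_-⁻¹) κ` with `κ` a
polynomial in `r` of degree at most `k`. Such polynomials are the sums of an element of `K_{r^k}` and
a constant; all elements of `K_{r^k}` do occur, and a nonzero constant occurs exactly when
`g_-⁻¹ ∈ H_{p'}^-` and `g_+ ∈ H_{p'}^+`. The first of these is incompatible with `g_- ∈ 𝓗_p^-`,
since `1 / (x - i)` is not in `L_1`.
-/

/-! ### Conjugation, products and elementary members of the Hardy classes -/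

lemma MemHardyPlus.conj_minus {p : ℝ≥0∞} {f : ℝ → ℂ} (hf : MemHardyPlus p f) :
    MemHardyMinus p (fun x => conj (f x)) := by
  obtain ⟨h0, F, hF, ⟨C, hC⟩, ht⟩ := hf
  have e : ∀ x y : ℝ, conj ((x : ℂ) - y * I) = x + y * I := fun x y => by
    simp [sub_eq_add_neg]
  refine ⟨h0.star, fun z => conj (F (conj z)), fun z hz => ?_, ⟨C, fun y hy => ?_⟩, ?_⟩
  · have hz' : conj z ∈ {z : ℂ | 0 < z.im} := by simpa using hz
    have := (hF.differentiableAt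
      ((isOpen_lt continuous_const continuous_im).mem_nhds hz')).conj_conj
    rw [conj_conj] at this
    exact this.differentiableWithinAt
  · refine le_of_eq_of_le (eLpNorm_congr_norm_ae (ae_of_all _ fun x => ?_)) (hC y hy)
    simp only [e, RCLike.norm_conj]
  · refine ht.congr fun y => eLpNorm_congr_norm_ae (ae_of_all _ fun x => ?_)
    simp only [e, ← map_sub, RCLike.norm_conj]

lemma MemHardyMinus.conj_plus {p : ℝ≥0∞} {f : ℝ → ℂ} (hf : MemHardyMinus p f) :
    MemHardyPlus p (fun x => conj (f x)) := by
  obtain ⟨h0, F, hF, ⟨C, hC⟩, ht⟩ := hf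
  have e : ∀ x y : ℝ, conj ((x : ℂ) + y * I) = x - y * I := fun x y => by
    simp [sub_eq_add_neg]
  refine ⟨h0.star, fun z => conj (F (conj z)), fun z hz => ?_, ⟨C, fun y hy => ?_⟩, ?_⟩
  · have hz' : conj z ∈ {z : ℂ | z.im < 0} := by simpa using hz
    have := (hF.differentiableAt
      ((isOpen_lt continuous_im continuous_const).mem_nhds hz')).conj_conj
    rw [conj_conj] at this
    exact this.differentiableWithinAt
  · refine le_of_eq_of_le (eLpNorm_congr_norm_ae (ae_of_all _ fun x => ?_)) (hC y hy)
    simp only [e, RCLike.norm_conj]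
  · refine ht.congr fun y => eLpNorm_congr_norm_ae (ae_of_all _ fun x => ?_)
    simp only [e, ← map_sub, RCLike.norm_conj]

lemma memHardyMinus_iff_conj {p : ℝ≥0∞} {f : ℝ → ℂ} :
    MemHardyMinus p f ↔ MemHardyPlus p (fun x => conj (f x)) :=
  ⟨fun h => h.conj_plus, fun h => by simpa using h.conj_minus⟩

/-- Products of Hardy functions, with Hölder exponents. The exponent `∞` is allowed: the class
`MemHardyPlus ∞` consists of bounded functions attained uniformly at the boundary, so that this
lemma also covers multiplication by rational functions such as `r`. -/
lemma MemHardyPlus.mul {a b t : ℝ≥0∞} [ENNReal.HolderTriple a b t] {f g : ℝ → ℂ}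
    (hf : MemHardyPlus a f) (hg : MemHardyPlus b g) : MemHardyPlus t (fun x => f x * g x) := by
  obtain ⟨h0, F, hF, ⟨C, hC⟩, ht⟩ := hf
  obtain ⟨k0, G, hG, ⟨D, hD⟩, kt⟩ := hg
  have mF : ∀ y : ℝ, 0 < y →
      AEStronglyMeasurable (fun x : ℝ => F ((x : ℂ) + (y : ℂ) * I)) volume := fun y hy =>
    aesm_of_diffOn hF _ (by fun_prop) (by simpa using hy)
  have mG : ∀ y : ℝ, 0 < y →
      AEStronglyMeasurable (fun x : ℝ => G ((x : ℂ) + (y : ℂ) * I)) volume := fun y hy =>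
    aesm_of_diffOn hG _ (by fun_prop) (by simpa using hy)
  refine ⟨k0.mul' h0, fun z => F z * G z, hF.mul hG, ⟨C * D, fun y hy => ?_⟩, ?_⟩
  · push_cast
    exact (eLpNorm_smul_le_mul_eLpNorm (mG y hy) (mF y hy)).trans
      (mul_le_mul' (hC y hy) (hD y hy))
  · have h1 : Tendsto (fun y : ℝ => eLpNorm ((fun x : ℝ => F ((x : ℂ) + (y : ℂ) * I) - f x) •
        (fun x : ℝ => G ((x : ℂ) + (y : ℂ) * I))) t volume) (𝓝[>] 0) (𝓝 0) := by
      have : Tendsto (fun y : ℝ => eLpNorm (fun x : ℝ => F ((x : ℂ) + (y : ℂ) * I) - f x) a volume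
          * D) (𝓝[>] 0) (𝓝 0) := by
        simpa using ENNReal.Tendsto.mul_const ht (Or.inr (ENNReal.coe_ne_top (r := D)))
      refine tendsto_of_tendsto_of_tendsto_of_le_of_le' tendsto_const_nhds this
        (Eventually.of_forall fun _ => zero_le) ?_
      filter_upwards [self_mem_nhdsWithin] with y hy
      exact (eLpNorm_smul_le_mul_eLpNorm (mG y hy) ((mF y hy).sub h0.1)).trans
        (mul_le_mul' le_rfl (hD y hy))
    have h2 : Tendsto (fun y : ℝ => eLpNorm (f •
        (fun x : ℝ => G ((x : ℂ) + (y : ℂ) * I) - g x)) t volume) (𝓝[>] 0) (𝓝 0) := by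
      have : Tendsto (fun y : ℝ => eLpNorm f a volume *
          eLpNorm (fun x : ℝ => G ((x : ℂ) + (y : ℂ) * I) - g x) b volume) (𝓝[>] 0) (𝓝 0) := by
        simpa using ENNReal.Tendsto.const_mul kt (Or.inr h0.2.ne)
      refine tendsto_of_tendsto_of_tendsto_of_le_of_le' tendsto_const_nhds this
        (Eventually.of_forall fun _ => zero_le) ?_
      filter_upwards [self_mem_nhdsWithin] with y hy
      exact eLpNorm_smul_le_mul_eLpNorm ((mG y hy).sub k0.1) h0.1
    refine (tendsto_eLpNorm_add (fun y hy => ((mF y hy).sub h0.1).smul (mG y hy))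
      (fun y hy => h0.1.smul ((mG y hy).sub k0.1)) h1 h2).congr fun y => ?_
    congr 1
    ext x
    simp only [Pi.add_apply, smul_eq_mul, Pi.mul_apply, Pi.sub_apply]
    ring

lemma MemHardyMinus.mul {a b t : ℝ≥0∞} [ENNReal.HolderTriple a b t] {f g : ℝ → ℂ}
    (hf : MemHardyMinus a f) (hg : MemHardyMinus b g) :
    MemHardyMinus t (fun x => f x * g x) := by
  rw [memHardyMinus_iff_conj] at *
  simpa using hf.mul hg (t := t)

lemma MemHardyPlus.sub {p : ℝ≥0∞} {f g : ℝ → ℂ} (hf : MemHardyPlus p f)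
    (hg : MemHardyPlus p g) : MemHardyPlus p (fun x => f x - g x) := by
  simpa [sub_eq_add_neg] using hf.add (hg.const_mul (-1))

lemma MemHardyMinus.sub {p : ℝ≥0∞} {f g : ℝ → ℂ} (hf : MemHardyMinus p f)
    (hg : MemHardyMinus p g) : MemHardyMinus p (fun x => f x - g x) := by
  simpa [sub_eq_add_neg] using hf.add (hg.const_mul (-1))

lemma memHardyPlus_const (c : ℂ) : MemHardyPlus ∞ (fun _ => c) :=
  ⟨memLp_top_const c, fun _ => c, differentiableOn_const _, ⟨‖c‖₊, fun y _ => by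
    refine (eLpNorm_exponent_top (f := fun _ : ℝ => c)).trans_le ?_
    exact eLpNormEssSup_le_of_ae_enorm_bound (ae_of_all _ fun _ => le_rfl)⟩, by
    simp only [sub_self, eLpNorm_zero', tendsto_const_nhds_iff]⟩

lemma ofReal_sub_ne_zero {w : ℂ} (hw : w.im ≠ 0) (x : ℝ) : (x : ℂ) - w ≠ 0 := fun h => by
  apply hw
  rw [← sub_eq_zero.1 h, ofReal_im]

lemma ofReal_add_I_ne_zero (x : ℝ) : (x : ℂ) + I ≠ 0 := by
  simpa using ofReal_sub_ne_zero (w := -I) (by simp) x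

lemma ofReal_sub_I_ne_zero (x : ℝ) : (x : ℂ) - I ≠ 0 :=
  ofReal_sub_ne_zero (w := I) (by simp) x

lemma memLp_one_add_sq_rpow {s : ℝ≥0∞} (hs : 1 < s) :
    MemLp (fun x : ℝ => (1 + x ^ 2) ^ (-(1 : ℝ) / 2)) s volume := by
  have hm : Continuous (fun x : ℝ => (1 + x ^ 2) ^ (-(1 : ℝ) / 2)) :=
    Continuous.rpow_const (by fun_prop) fun x => Or.inl (by positivity)
  rcases eq_or_ne s ∞ with rfl | hs'
  · refine memLp_top_of_bound hm.aestronglyMeasurable 1 (ae_of_all _ fun x => ?_)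
    rw [Real.norm_of_nonneg (by positivity)]
    exact Real.rpow_le_one_of_one_le_of_nonpos (by nlinarith [sq_nonneg x]) (by norm_num)
  · have hs1 : 1 < s.toReal := by
      simpa using (ENNReal.toReal_lt_toReal ENNReal.one_ne_top hs').2 hs
    rw [← integrable_norm_rpow_iff hm.aestronglyMeasurable (by positivity) hs']
    refine (integrable_rpow_neg_one_add_norm_sq (E := ℝ) (μ := volume) (r := s.toReal)
      (by simpa using hs1)).congr (ae_of_all _ fun x => ?_)
    have h0 : 0 ≤ (1 + x ^ 2) ^ (-(1 : ℝ) / 2) := by positivity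
    have h1 : 0 ≤ 1 + x ^ 2 := by positivity
    simp only [Real.norm_eq_abs, sq_abs, abs_of_nonneg h0]
    rw [← Real.rpow_mul h1]
    congr 1
    ring

lemma norm_inv_ofReal_sub_le {w : ℂ} (hw : w.im ≠ 0) :
    ∃ K : ℝ, ∀ x : ℝ, ‖((x : ℂ) - w)⁻¹‖ ≤ K * (1 + x ^ 2) ^ (-(1 : ℝ) / 2) := by
  have hb : 0 < w.im ^ 2 := by positivity
  refine ⟨√(2 + (1 + 2 * w.re ^ 2) / w.im ^ 2), fun x => ?_⟩
  have h1 : ‖(x : ℂ) - w‖ = √((x - w.re) ^ 2 + w.im ^ 2) := by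
    rw [Complex.norm_eq_sqrt_sq_add_sq]; simp
  have h2 : (1 + x ^ 2) ^ (-(1 : ℝ) / 2) = (√(1 + x ^ 2))⁻¹ := by
    rw [Real.sqrt_eq_rpow, ← Real.rpow_neg (by positivity)]
    norm_num
  rw [norm_inv, h1, h2, inv_le_iff_one_le_mul₀ (by positivity), mul_right_comm,
    ← Real.sqrt_mul (by positivity), ← div_eq_mul_inv, le_div_iff₀ (by positivity), one_mul]
  apply Real.sqrt_le_sqrt
  have h3 : (2 + (1 + 2 * w.re ^ 2) / w.im ^ 2) * ((x - w.re) ^ 2 + w.im ^ 2) =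
      2 * (x - w.re) ^ 2 + 2 * w.im ^ 2 + (1 + 2 * w.re ^ 2)
        + (1 + 2 * w.re ^ 2) / w.im ^ 2 * (x - w.re) ^ 2 := by
    field_simp
    ring
  rw [h3]
  have : 0 ≤ (1 + 2 * w.re ^ 2) / w.im ^ 2 * (x - w.re) ^ 2 := by positivity
  nlinarith [sq_nonneg (x - 2 * w.re)]

lemma memLp_inv_ofReal_sub {w : ℂ} (hw : w.im ≠ 0) {s : ℝ≥0∞} (hs : 1 < s) :
    MemLp (fun x : ℝ => ((x : ℂ) - w)⁻¹) s volume := by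
  obtain ⟨K, hK⟩ := norm_inv_ofReal_sub_le hw
  have hc : Continuous (fun x : ℝ => ((x : ℂ) - w)⁻¹) :=
    Continuous.inv₀ (by fun_prop) (ofReal_sub_ne_zero hw)
  refine (memLp_one_add_sq_rpow hs).of_le_mul (c := K) hc.aestronglyMeasurable
    (ae_of_all _ fun x => ?_)
  rw [Real.norm_of_nonneg (by positivity)]
  exact hK x

lemma memHardyPlus_inv_sub {w : ℂ} (hw : w.im < 0) {s : ℝ≥0∞} (hs : 1 < s) :
    MemHardyPlus s (fun x : ℝ => ((x : ℂ) - w)⁻¹) := by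
  have hL := memLp_inv_ofReal_sub hw.ne hs
  have hle : ∀ y : ℝ, 0 < y → ∀ x : ℝ, ‖((x : ℂ) + y * I - w)⁻¹‖ ≤ ‖((x : ℂ) - w)⁻¹‖ := by
    intro y hy x
    rw [norm_inv, norm_inv]
    apply inv_anti₀ (norm_pos_iff.2 (ofReal_sub_ne_zero hw.ne x))
    rw [Complex.norm_eq_sqrt_sq_add_sq, Complex.norm_eq_sqrt_sq_add_sq]
    apply Real.sqrt_le_sqrt
    simp
    nlinarith
  refine ⟨hL, fun z => (z - w)⁻¹, ?_, ⟨(eLpNorm (fun x : ℝ => ((x : ℂ) - w)⁻¹) s volume).toNNReal,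
    fun y hy => ?_⟩, ?_⟩
  · refine DifferentiableOn.inv (by fun_prop) fun z hz h => ?_
    rw [sub_eq_zero.1 h] at hz
    exact lt_asymm hw hz
  · rw [ENNReal.coe_toNNReal hL.2.ne]
    exact eLpNorm_mono (hle y hy)
  · have h2 : Tendsto (fun y : ℝ => ENNReal.ofReal (y / -w.im) *
        eLpNorm (fun x : ℝ => ((x : ℂ) - w)⁻¹) s volume) (𝓝[>] 0) (𝓝 0) := by
      have h3 : Tendsto (fun y : ℝ => ENNReal.ofReal (y / -w.im)) (𝓝[>] 0) (𝓝 0) := by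
        have : Continuous (fun y : ℝ => ENNReal.ofReal (y / -w.im)) :=
        ENNReal.continuous_ofReal.comp (by fun_prop)
        simpa using (this.tendsto 0).mono_left nhdsWithin_le_nhds
      simpa using ENNReal.Tendsto.mul_const h3 (Or.inr hL.2.ne)
    refine tendsto_of_tendsto_of_tendsto_of_le_of_le' tendsto_const_nhds h2
        (Eventually.of_forall fun _ => zero_le) ?_
    filter_upwards [self_mem_nhdsWithin] with y hy
    refine eLpNorm_le_mul_eLpNorm_of_ae_le_mul (ae_of_all _ fun x => ?_) s
    have hy' : 0 < y := hy
    have n1 : (x : ℂ) + y * I - w ≠ 0 := fun h => by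
      have := congrArg im h
      simp at this
      linarith
    have n2 := ofReal_sub_ne_zero hw.ne x
    have e : ((x : ℂ) + y * I - w)⁻¹ - ((x : ℂ) - w)⁻¹ =
        -(y * I) * ((x : ℂ) + y * I - w)⁻¹ * ((x : ℂ) - w)⁻¹ := by
      field_simp
      ring
    rw [e, norm_mul, norm_mul, norm_neg, norm_mul, norm_I, mul_one, norm_real,
      Real.norm_of_nonneg hy'.le, div_eq_mul_inv]
    gcongr
    rw [norm_inv]
    apply inv_anti₀ (by linarith)
    have := Complex.abs_im_le_norm ((x : ℂ) + y * I - w)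
    simp at this
    exact le_trans (by rw [abs_of_pos (by linarith)]; linarith) this

lemma memHardyMinus_inv_sub {w : ℂ} (hw : 0 < w.im) {s : ℝ≥0∞} (hs : 1 < s) :
    MemHardyMinus s (fun x : ℝ => ((x : ℂ) - w)⁻¹) := by
  rw [memHardyMinus_iff_conj]
  simpa using memHardyPlus_inv_sub (w := conj w) (by simpa using hw) hs

lemma rFun_ne_zero (x : ℝ) : rFun x ≠ 0 :=
  div_ne_zero (ofReal_sub_I_ne_zero x) (ofReal_add_I_ne_zero x)

lemma conj_rFun (x : ℝ) : conj (rFun x) = (rFun x)⁻¹ := by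
  simp [rFun, sub_eq_add_neg]

lemma rFun_eq (x : ℝ) : rFun x = 1 - 2 * I * ((x : ℂ) + I)⁻¹ := by
  have := ofReal_add_I_ne_zero x
  rw [rFun]
  field_simp
  ring

lemma rFun_inv_eq (x : ℝ) : (rFun x)⁻¹ = 1 + 2 * I * ((x : ℂ) - I)⁻¹ := by
  have := ofReal_sub_I_ne_zero x
  rw [rFun, inv_div]
  field_simp
  ring

lemma memHardyPlus_inv_add_I {s : ℝ≥0∞} (hs : 1 < s) :
    MemHardyPlus s (fun x : ℝ => ((x : ℂ) + I)⁻¹) := by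
  simpa using memHardyPlus_inv_sub (w := -I) (by simp) hs

lemma memHardyMinus_inv_sub_I {s : ℝ≥0∞} (hs : 1 < s) :
    MemHardyMinus s (fun x : ℝ => ((x : ℂ) - I)⁻¹) :=
  memHardyMinus_inv_sub (w := I) (by simp) hs

lemma memHardyPlus_rFun_pow (n : ℕ) : MemHardyPlus ∞ (fun x => rFun x ^ n) := by
  induction n with
  | zero => simpa using memHardyPlus_const 1
  | succ n ih =>
    have h : MemHardyPlus ∞ rFun := by
      have := (memHardyPlus_const 1).sub
        ((memHardyPlus_inv_add_I (s := ∞) (by simp)).const_mul (2 * I))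
      exact this.congr (ae_of_all _ fun x => (rFun_eq x).symm)
    simpa [pow_succ] using ih.mul h (t := ∞)

lemma memHardyMinus_rFun_inv_pow (n : ℕ) : MemHardyMinus ∞ (fun x => (rFun x)⁻¹ ^ n) := by
  have := (memHardyPlus_rFun_pow n).conj_minus
  simpa [conj_rFun] using this

/-! ### The integral of a function of the Hardy space `H_1` vanishes -/

lemma integral_line_eq {F : ℂ → ℂ} (hF : DifferentiableOn ℂ F {z : ℂ | 0 < z.im}) {C : ℝ≥0}
    (hC : ∀ y : ℝ, 0 < y → eLpNorm (fun x : ℝ => F ((x : ℂ) + (y : ℂ) * I)) 1 volume ≤ C)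
    {a b : ℝ} (ha : 0 < a) (hab : a ≤ b) :
    ∫ x : ℝ, F ((x : ℂ) + (a : ℂ) * I) = ∫ x : ℝ, F ((x : ℂ) + (b : ℂ) * I) := by
  have hint : ∀ y : ℝ, 0 < y → Integrable (fun x : ℝ => F ((x : ℂ) + (y : ℂ) * I)) := fun y hy =>
    memLp_one_iff_integrable.1 ⟨aesm_of_diffOn hF _ (by fun_prop) (by simpa using hy),
      (hC y hy).trans_lt ENNReal.coe_lt_top⟩
  -- the integral over the vertical side of the rectangle, as a function of its abscissa
  have hprod : Integrable (fun z : ℝ × ℝ => F ((z.1 : ℂ) + (z.2 : ℂ) * I))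
      (volume.prod (volume.restrict (Set.Ioc a b))) := by
    have hm : AEStronglyMeasurable (fun z : ℝ × ℝ => F ((z.1 : ℂ) + (z.2 : ℂ) * I))
        (volume.prod (volume.restrict (Set.Ioc a b))) := by
      have : (volume : Measure ℝ).prod (volume.restrict (Set.Ioc a b)) =
          (volume.prod volume).restrict (Set.univ ×ˢ Set.Ioc a b) := by
        rw [← Measure.prod_restrict, Measure.restrict_univ]
      rw [this]
      refine ContinuousOn.aestronglyMeasurable ?_ (MeasurableSet.univ.prod measurableSet_Ioc)
      refine hF.continuousOn.comp (by fun_prop) fun z hz => ?_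
      simpa using ha.trans hz.2.1
    rw [integrable_prod_iff' hm]
    constructor
    · filter_upwards [ae_restrict_mem measurableSet_Ioc] with y hy
      exact hint y (ha.trans hy.1)
    · refine Integrable.of_bound (C := C) hm.norm.prod_swap.integral_prod_right' ?_
      filter_upwards [ae_restrict_mem measurableSet_Ioc] with y hy
      rw [Real.norm_of_nonneg (integral_nonneg fun _ => norm_nonneg _)]
      rw [integral_norm_eq_lintegral_enorm (hint y (ha.trans hy.1)).1]
      have := hC y (ha.trans hy.1)
      rw [eLpNorm_one_eq_lintegral_enorm] at this
      simpa using ENNReal.toReal_mono ENNReal.coe_ne_top this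
  have hv : Integrable (fun x : ℝ => ∫ y in a..b, F ((x : ℂ) + (y : ℂ) * I)) := by
    simpa only [intervalIntegral.integral_of_le hab] using hprod.integral_prod_left
  have hw : Integrable (fun R : ℝ => ‖∫ y in a..b, F ((R : ℂ) + (y : ℂ) * I)‖ +
      ‖∫ y in a..b, F (((-R : ℝ) : ℂ) + (y : ℂ) * I)‖) :=
    hv.norm.add (hv.comp_neg).norm
  have hrect : ∀ R : ℝ, 0 < R →
      ‖(∫ x in (-R)..R, F ((x : ℂ) + (a : ℂ) * I)) - ∫ x in (-R)..R, F ((x : ℂ) + (b : ℂ) * I)‖ ≤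
      ‖∫ y in a..b, F ((R : ℂ) + (y : ℂ) * I)‖ +
      ‖∫ y in a..b, F (((-R : ℝ) : ℂ) + (y : ℂ) * I)‖ := by
    intro R hR
    have h := integral_boundary_rect_eq_zero_of_differentiableOn F
      (((-R : ℝ) : ℂ) + (a : ℂ) * I) ((R : ℂ) + (b : ℂ) * I) (hF.mono fun z hz => ?_)
    · have e1 : (((-R : ℝ) : ℂ) + (a : ℂ) * I).re = -R := by simp
      have e2 : (((-R : ℝ) : ℂ) + (a : ℂ) * I).im = a := by simp
      have e3 : ((R : ℂ) + (b : ℂ) * I).re = R := by simp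
      have e4 : ((R : ℂ) + (b : ℂ) * I).im = b := by simp
      rw [e1, e2, e3, e4] at h
      have h' : (∫ x in (-R)..R, F ((x : ℂ) + (a : ℂ) * I)) -
          ∫ x in (-R)..R, F ((x : ℂ) + (b : ℂ) * I) =
          I • (∫ y in a..b, F (((-R : ℝ) : ℂ) + (y : ℂ) * I)) -
          I • (∫ y in a..b, F ((R : ℂ) + (y : ℂ) * I)) := by
        linear_combination h
      rw [h', add_comm]
      refine (norm_sub_le _ _).trans ?_
      simp only [norm_smul, norm_I, one_mul, le_refl]
    · have h2 := hz.2
      simp only [Set.mem_preimage, add_im, ofReal_im, mul_im, ofReal_re, I_im, I_re, mul_one,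
        mul_zero, zero_add, add_zero, Set.uIcc_of_le hab] at h2
      exact ha.trans_le h2.1
  by_contra hne
  have hL : 0 < ‖(∫ x : ℝ, F ((x : ℂ) + (a : ℂ) * I)) - ∫ x : ℝ, F ((x : ℂ) + (b : ℂ) * I)‖ :=
    norm_pos_iff.2 (sub_ne_zero.2 hne)
  set L := ‖(∫ x : ℝ, F ((x : ℂ) + (a : ℂ) * I)) - ∫ x : ℝ, F ((x : ℂ) + (b : ℂ) * I)‖ with hLdef
  have hlim : Tendsto (fun R : ℝ => ‖(∫ x in (-R)..R, F ((x : ℂ) + (a : ℂ) * I)) -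
      ∫ x in (-R)..R, F ((x : ℂ) + (b : ℂ) * I)‖) atTop (𝓝 L) :=
    ((intervalIntegral_tendsto_integral (hint a ha) tendsto_neg_atTop_atBot tendsto_id).sub
      (intervalIntegral_tendsto_integral (hint b (ha.trans_le hab)) tendsto_neg_atTop_atBot
        tendsto_id)).norm
  obtain ⟨R₀, hR₀⟩ := eventually_atTop.1 ((hlim.eventually (lt_mem_nhds (half_lt_self hL))).and
    (eventually_gt_atTop 0))
  have hconst : IntegrableOn (fun _ : ℝ => L / 2) (Set.Ioi R₀) := by
    refine Integrable.mono' (hw.integrableOn (s := Set.Ioi R₀)) aestronglyMeasurable_const ?_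
    filter_upwards [ae_restrict_mem measurableSet_Ioi] with R hR
    have h := hR₀ R (le_of_lt hR)
    rw [Real.norm_of_nonneg (by positivity)]
    exact h.1.le.trans (hrect R h.2)
  rw [integrableOn_const_iff enorm_ne_top] at hconst
  simp [hL.ne'] at hconst

lemma integral_line_eq_zero {F : ℂ → ℂ} (hF : DifferentiableOn ℂ F {z : ℂ | 0 < z.im}) {C : ℝ≥0}
    (hC : ∀ y : ℝ, 0 < y → eLpNorm (fun x : ℝ => F ((x : ℂ) + (y : ℂ) * I)) 1 volume ≤ C)
    {a : ℝ} (ha : 0 < a) : ∫ x : ℝ, F ((x : ℂ) + (a : ℂ) * I) = 0 := by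
  have hm : ∀ y : ℝ, 0 < y →
      AEStronglyMeasurable (fun x : ℝ => F ((x : ℂ) + (y : ℂ) * I)) volume := fun y hy =>
    aesm_of_diffOn hF _ (by fun_prop) (by simpa using hy)
  have hint : ∀ y : ℝ, 0 < y → Integrable (fun x : ℝ => F ((x : ℂ) + (y : ℂ) * I)) := fun y hy =>
    memLp_one_iff_integrable.1 ⟨hm y hy, (hC y hy).trans_lt ENNReal.coe_lt_top⟩
  have hne : ∀ (l x y : ℝ), ‖cexp (I * l * ((x : ℂ) + (y : ℂ) * I))‖ = Real.exp (-(l * y)) := by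
    intro l x y
    rw [Complex.norm_exp]
    simp
  -- with the factor `exp (iλz)`, `λ > 0`, the integral over a line decays with the height
  have hl : ∀ l : ℝ, 0 < l →
      ∫ x : ℝ, F ((x : ℂ) + (a : ℂ) * I) * cexp (I * l * ((x : ℂ) + (a : ℂ) * I)) = 0 := by
    intro l hl
    have hlim : Tendsto (fun b : ℝ => Real.exp (-(l * b)) * C) atTop (𝓝 0) := by
      have : Tendsto (fun b : ℝ => Real.exp (-(l * b))) atTop (𝓝 0) :=
        Real.tendsto_exp_neg_atTop_nhds_zero.comp (tendsto_id.const_mul_atTop hl)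
      simpa using this.mul_const (C : ℝ)
    refine norm_le_zero_iff.1 (ge_of_tendsto hlim ?_)
    filter_upwards [eventually_ge_atTop a] with b hb
    have hb0 : 0 < b := ha.trans_le hb
    rw [integral_line_eq (F := fun z => F z * cexp (I * l * z)) (C := C) (hF.mul (by fun_prop))
      (fun y hy => (eLpNorm_mono fun x => ?_).trans (hC y hy)) ha hb]
    · refine (norm_integral_le_integral_norm _).trans ?_
      simp only [norm_mul, hne]
      rw [integral_mul_const, mul_comm]
      gcongr
      rw [integral_norm_eq_lintegral_enorm (hint b hb0).1]
      have := hC b hb0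
      rw [eLpNorm_one_eq_lintegral_enorm] at this
      simpa using ENNReal.toReal_mono ENNReal.coe_ne_top this
    · rw [norm_mul, hne]
      refine mul_le_of_le_one_right (norm_nonneg _) (Real.exp_le_one_iff.2 ?_)
      have := mul_pos hl hy
      linarith
  have hlim : Tendsto (fun l : ℝ => ∫ x : ℝ, F ((x : ℂ) + (a : ℂ) * I) *
      cexp (I * l * ((x : ℂ) + (a : ℂ) * I))) (𝓝[>] 0)
      (𝓝 (∫ x : ℝ, F ((x : ℂ) + (a : ℂ) * I))) := by
    refine tendsto_integral_filter_of_dominated_convergence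
      (fun x => ‖F ((x : ℂ) + (a : ℂ) * I)‖) ?_ ?_ (hint a ha).norm ?_
    · exact Eventually.of_forall fun l =>
        (hm a ha).mul (Continuous.aestronglyMeasurable (by fun_prop))
    · filter_upwards [self_mem_nhdsWithin] with l hl
      refine ae_of_all _ fun x => ?_
      rw [norm_mul, hne]
      refine mul_le_of_le_one_right (norm_nonneg _) (Real.exp_le_one_iff.2 ?_)
      have := mul_pos (show 0 < l from hl) ha
      linarith
    · refine ae_of_all _ fun x => ?_
      have hc : Continuous (fun l : ℝ => F ((x : ℂ) + (a : ℂ) * I) *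
        cexp (I * l * ((x : ℂ) + (a : ℂ) * I))) := by fun_prop
      simpa using (hc.tendsto 0).mono_left nhdsWithin_le_nhds
  refine tendsto_nhds_unique hlim (tendsto_const_nhds.congr' ?_)
  filter_upwards [self_mem_nhdsWithin] with l hl'
  exact (hl l hl').symm

lemma MemHardyPlus.integral_eq_zero {f : ℝ → ℂ} (hf : MemHardyPlus 1 f) : ∫ x, f x = 0 := by
  obtain ⟨h0, F, hF, ⟨C, hC⟩, ht⟩ := hf
  have hlim : Tendsto (fun y : ℝ => ∫ x : ℝ, F ((x : ℂ) + (y : ℂ) * I)) (𝓝[>] 0)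
      (𝓝 (∫ x, f x)) := by
    refine tendsto_integral_of_L1' f h0.1 ?_ ht
    filter_upwards [self_mem_nhdsWithin] with y hy
    exact memLp_one_iff_integrable.1 ⟨aesm_of_diffOn hF _ (by fun_prop) (by simpa using hy),
      (hC y hy).trans_lt ENNReal.coe_lt_top⟩
  refine tendsto_nhds_unique hlim (tendsto_const_nhds.congr' ?_)
  filter_upwards [self_mem_nhdsWithin] with y hy
  exact (integral_line_eq_zero hF hC hy).symm

lemma MemHardyMinus.integral_eq_zero {f : ℝ → ℂ} (hf : MemHardyMinus 1 f) : ∫ x, f x = 0 := by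
  have := hf.conj_plus.integral_eq_zero
  rw [integral_conj] at this
  simpa using this

/-! ### Poisson integrals -/

/-- The Poisson integral of `f` at the point `x + iy`, written as the mean of `s ↦ f (x + ys)` with
respect to the standard Cauchy distribution. -/
noncomputable def poissonInt (f : ℝ → ℂ) (y x : ℝ) : ℂ :=
  ∫ s, f (x + y * s) ∂ProbabilityTheory.cauchyMeasure 0 1

/-- Jensen's inequality and Tonelli's theorem: the `L_t` norm of a mean of functions with respect to
a probability measure. -/
lemma eLpNorm_integral_rpow_le {μ : Measure ℝ} [IsProbabilityMeasure μ] {t : ℝ≥0∞} (ht : 1 ≤ t)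
    (ht' : t ≠ ∞) {K : ℝ → ℝ → ℂ}
    (hK : StronglyMeasurable (Function.uncurry K)) :
    eLpNorm (fun x => ∫ s, K x s ∂μ) t volume ^ t.toReal ≤
      ∫⁻ s, eLpNorm (fun x => K x s) t volume ^ t.toReal ∂μ := by
  have ht0 : t ≠ 0 := (zero_lt_one.trans_le ht).ne'
  have hT : 0 < t.toReal := ENNReal.toReal_pos ht0 ht'
  have e : ∀ (ν : Measure ℝ) (u : ℝ → ℂ), eLpNorm u t ν ^ t.toReal = ∫⁻ x, ‖u x‖ₑ ^ t.toReal ∂ν :=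
    fun ν u => by
      rw [eLpNorm_eq_lintegral_rpow_enorm_toReal ht0 ht', ← ENNReal.rpow_mul,
        one_div_mul_cancel hT.ne', ENNReal.rpow_one]
  rw [e]
  simp only [e]
  rw [← lintegral_lintegral_swap (f := fun x s => ‖K x s‖ₑ ^ t.toReal)
    (hK.enorm.pow_const _).aemeasurable]
  refine lintegral_mono fun x => ?_
  calc ‖∫ s, K x s ∂μ‖ₑ ^ t.toReal ≤ (eLpNorm (K x) 1 μ) ^ t.toReal := by
        gcongr
        rw [eLpNorm_one_eq_lintegral_enorm]
        exact enorm_integral_le_lintegral_enorm _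
    _ ≤ (eLpNorm (K x) t μ) ^ t.toReal := by
        gcongr
        exact eLpNorm_le_eLpNorm_of_exponent_le ht
          (hK.comp_measurable measurable_prodMk_left).aestronglyMeasurable
    _ = ∫⁻ s, ‖K x s‖ₑ ^ t.toReal ∂μ := e μ (K x)

lemma eLpNorm_translate {f : ℝ → ℂ} (hf : StronglyMeasurable f) (t : ℝ≥0∞) (s : ℝ) :
    eLpNorm (fun x => f (x + s)) t volume = eLpNorm f t volume :=
  eLpNorm_comp_measurePreserving hf.aestronglyMeasurable (measurePreserving_add_right volume s)

lemma eLpNorm_poissonInt_le {f : ℝ → ℂ} (hf : StronglyMeasurable f) {t : ℝ≥0∞} (ht : 1 ≤ t)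
    (ht' : t ≠ ∞) (y : ℝ) : eLpNorm (poissonInt f y) t volume ≤ eLpNorm f t volume := by
  have hT : 0 < t.toReal := ENNReal.toReal_pos (zero_lt_one.trans_le ht).ne' ht'
  have h := eLpNorm_integral_rpow_le (μ := ProbabilityTheory.cauchyMeasure 0 1) ht ht'
    (K := fun x s => f (x + y * s)) (hf.comp_measurable (by fun_prop))
  simp only [eLpNorm_translate hf] at h
  rw [lintegral_const, measure_univ, mul_one] at h
  exact (ENNReal.rpow_le_rpow_iff hT).1 h

/-- Translation is continuous in `L_t`, `1 ≤ t < ∞`. -/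
lemma continuous_eLpNorm_translate_sub {f : ℝ → ℂ} {t : ℝ≥0∞} (ht : 1 ≤ t)
    (ht' : t ≠ ∞) (hf : MemLp f t volume) :
    Continuous (fun s : ℝ => eLpNorm (fun x => f (x + s) - f x) t volume) := by
  have : Fact (1 ≤ t) := ⟨ht⟩
  let g : C(ℝ, C(ℝ, ℝ)) := (ContinuousMap.mk (fun a : ℝ × ℝ => a.2 + a.1) (by fun_prop)).curry
  have hgm : ∀ s, MeasurePreserving (g s) (volume : Measure ℝ) volume := fun s =>
    measurePreserving_add_right volume s
  have hc : Continuous fun s : ℝ => Lp.compMeasurePreserving (g s) (hgm s) (hf.toLp f) :=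
    continuous_const.compMeasurePreservingLp g.continuous hgm ht'
  have h2 : Continuous fun s : ℝ =>
      ‖Lp.compMeasurePreserving (g s) (hgm s) (hf.toLp f) - hf.toLp f‖ₑ :=
    (hc.sub continuous_const).enorm
  refine h2.congr fun s => ?_
  rw [Lp.enorm_def]
  refine eLpNorm_congr_ae ?_
  have h3 := hf.coeFn_toLp
  filter_upwards [Lp.coeFn_sub (Lp.compMeasurePreserving (g s) (hgm s) (hf.toLp f)) (hf.toLp f),
    Lp.coeFn_compMeasurePreserving (hf.toLp f) (hgm s), h3,
    (hgm s).quasiMeasurePreserving.ae h3] with x h4 h5 h6 h7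
  rw [h4, Pi.sub_apply, h5, h6, Function.comp_apply, h7]
  rfl

lemma tendsto_poissonInt_sub {f : ℝ → ℂ} (hf : StronglyMeasurable f) {t : ℝ≥0∞} (ht : 1 ≤ t)
    (ht' : t ≠ ∞) (hL : MemLp f t volume)
    (hint : ∀ y : ℝ, 0 < y → ∀ x : ℝ,
      Integrable (fun s => f (x + y * s)) (ProbabilityTheory.cauchyMeasure 0 1)) :
    Tendsto (fun y : ℝ => eLpNorm (fun x => poissonInt f y x - f x) t volume) (𝓝[>] 0) (𝓝 0) := by
  have hT : 0 < t.toReal := ENNReal.toReal_pos (zero_lt_one.trans_le ht).ne' ht'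
  have hc := continuous_eLpNorm_translate_sub ht ht' hL
  have hb : ∀ s : ℝ, eLpNorm (fun x => f (x + s) - f x) t volume ≤ 2 * eLpNorm f t volume :=
    fun s => by
      refine (eLpNorm_sub_le (f := fun x => f (x + s)) (g := f) (hf.comp_measurable
        (by fun_prop)).aestronglyMeasurable hf.aestronglyMeasurable ht).trans ?_
      rw [eLpNorm_translate hf, two_mul]
  have h1 : Tendsto (fun y : ℝ => ∫⁻ s, eLpNorm (fun x => f (x + y * s) - f x) t volume ^ t.toReal
      ∂ProbabilityTheory.cauchyMeasure 0 1) (𝓝[>] 0) (𝓝 (∫⁻ s, 0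
      ∂ProbabilityTheory.cauchyMeasure 0 1)) := by
    refine tendsto_lintegral_filter_of_dominated_convergence
      (fun _ => (2 * eLpNorm f t volume) ^ t.toReal) ?_ ?_ ?_ ?_
    · refine Eventually.of_forall fun y => ?_
      have : Continuous fun s : ℝ => eLpNorm (fun x => f (x + y * s) - f x) t volume :=
        hc.comp (continuous_const.mul continuous_id)
      exact this.measurable.pow_const _
    · exact Eventually.of_forall fun y => ae_of_all _ fun s =>
        ENNReal.rpow_le_rpow (hb _) hT.le
    · rw [lintegral_const, measure_univ, mul_one]
      exact ENNReal.rpow_ne_top_of_nonneg hT.le (ENNReal.mul_ne_top (by simp) hL.2.ne)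
    · refine ae_of_all _ fun s => ?_
      have h2 : Continuous fun y : ℝ => eLpNorm (fun x => f (x + y * s) - f x) t volume ^ t.toReal :=
        (ENNReal.continuous_rpow_const).comp (hc.comp (continuous_id.mul continuous_const))
      have h3 := (h2.tendsto 0).mono_left (nhdsWithin_le_nhds (s := Set.Ioi 0))
      simpa [hT] using h3
  have h4 : Tendsto (fun y : ℝ => eLpNorm (fun x => poissonInt f y x - f x) t volume ^ t.toReal)
      (𝓝[>] 0) (𝓝 0) := by
    rw [lintegral_zero] at h1
    refine tendsto_of_tendsto_of_tendsto_of_le_of_le' tendsto_const_nhds h1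
        (Eventually.of_forall fun _ => zero_le) ?_
    filter_upwards [self_mem_nhdsWithin] with y hy
    refine le_of_eq_of_le ?_ (eLpNorm_integral_rpow_le
      (μ := ProbabilityTheory.cauchyMeasure 0 1) ht ht'
      (K := fun x s => f (x + y * s) - f x) ((hf.comp_measurable (by fun_prop)).sub
        (hf.comp_measurable (by fun_prop))))
    congr 2
    ext x
    rw [integral_sub (hint y hy x) (integrable_const _), integral_const, probReal_univ, one_smul,
      poissonInt]
  have h5 := (ENNReal.continuous_rpow_const (y := t.toReal⁻¹)).tendsto 0 |>.comp h4
  simpa [Function.comp_def, ← ENNReal.rpow_mul, hT.ne', hT] using h5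

/-! ### Cauchy integrals -/

/-- The Cauchy integral `(2πi)⁻¹ ∫ f(u) / (u - z) du` of a function on the line. -/
noncomputable def lineCauchy (f : ℝ → ℂ) (z : ℂ) : ℂ :=
  (2 * Real.pi * I)⁻¹ * ∫ u : ℝ, f u * ((u : ℂ) - z)⁻¹

lemma integrable_mul_inv_sub {f : ℝ → ℂ} {t : ℝ≥0∞} (ht : 1 ≤ t) (ht' : t ≠ ∞)
    (hf : MemLp f t volume) {w : ℂ} (hw : w.im ≠ 0) :
    Integrable (fun u : ℝ => f u * ((u : ℂ) - w)⁻¹) := by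
  have : Fact (1 ≤ t) := ⟨ht⟩
  have h1 : 1 < ENNReal.conjExponent t :=
    (ENNReal.HolderConjugate.lt_top_iff_one_lt t (ENNReal.conjExponent t)).1 ht'.lt_top
  exact hf.integrable_mul (q := ENNReal.conjExponent t) (memLp_inv_ofReal_sub hw h1)

lemma differentiableAt_lineCauchy {f : ℝ → ℂ} {t : ℝ≥0∞} (ht : 1 ≤ t) (ht' : t ≠ ∞)
    (hf : MemLp f t volume) {w : ℂ} (hw : w.im ≠ 0) : DifferentiableAt ℂ (lineCauchy f) w := by
  have hδ : 0 < |w.im| / 2 := by positivity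
  have him : ∀ z ∈ Metric.ball w (|w.im| / 2), |w.im| / 2 ≤ |z.im| := fun z hz => by
    have h1 := (Complex.abs_im_le_norm (z - w)).trans (mem_ball_iff_norm.1 hz).le
    rw [sub_im] at h1
    have := abs_sub_abs_le_abs_sub w.im z.im
    rw [abs_sub_comm] at h1
    linarith
  have hne : ∀ z ∈ Metric.ball w (|w.im| / 2), z.im ≠ 0 := fun z hz =>
    abs_pos.1 (hδ.trans_le (him z hz))
  have h := hasDerivAt_integral_of_dominated_loc_of_deriv_le (𝕜 := ℂ) (μ := volume)
    (F := fun z (u : ℝ) => f u * ((u : ℂ) - z)⁻¹)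
    (F' := fun z (u : ℝ) => f u * (((u : ℂ) - z) ^ 2)⁻¹) (x₀ := w)
    (bound := fun u => ‖f u * ((u : ℂ) - w)⁻¹‖ * (2 * (|w.im| / 2)⁻¹))
    (Metric.ball_mem_nhds w hδ) ?_ (integrable_mul_inv_sub ht ht' hf hw) ?_ ?_ ?_ ?_
  · exact (h.2.const_mul (2 * Real.pi * I)⁻¹).differentiableAt
  · filter_upwards [Metric.ball_mem_nhds w hδ] with z hz
    exact (integrable_mul_inv_sub ht ht' hf (hne z hz)).1
  · exact hf.1.mul (Continuous.aestronglyMeasurable (Continuous.inv₀ (by fun_prop)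
      fun u => pow_ne_zero 2 (ofReal_sub_ne_zero hw u)))
  · refine ae_of_all _ fun u z hz => ?_
    have hz0 := norm_pos_iff.2 (ofReal_sub_ne_zero (hne z hz) u)
    have hw0 := norm_pos_iff.2 (ofReal_sub_ne_zero hw u)
    have h1 : |w.im| / 2 ≤ ‖(u : ℂ) - z‖ := (him z hz).trans (by
      simpa using Complex.abs_im_le_norm ((u : ℂ) - z))
    have h2 : ‖(u : ℂ) - w‖ ≤ 2 * ‖(u : ℂ) - z‖ := by
      have h3 := norm_sub_le_norm_sub_add_norm_sub (u : ℂ) z w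
      have h4 := (mem_ball_iff_norm.1 hz).le
      linarith
    rw [norm_mul, norm_mul, norm_inv, norm_inv, norm_pow, mul_assoc]
    gcongr
    rw [← mul_assoc, ← div_eq_mul_inv, inv_eq_one_div, inv_mul_eq_div, div_div,
      div_le_div_iff₀ (by positivity) (by positivity)]
    nlinarith
  · exact (integrable_mul_inv_sub ht ht' hf hw).norm.mul_const _
  · refine ae_of_all _ fun u z hz => ?_
    have h0 := ofReal_sub_ne_zero (hne z hz) u
    have h1 : HasDerivAt (fun z : ℂ => ((u : ℂ) - z)⁻¹) (-(-1) / ((u : ℂ) - z) ^ 2) z :=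
      ((hasDerivAt_id z).const_sub (u : ℂ)).inv h0
    have h2 := h1.const_mul (f u)
    simpa [div_eq_mul_inv] using h2

lemma cauchyMeasure_zero_one : ProbabilityTheory.cauchyMeasure 0 1 =
    volume.withDensity fun s : ℝ => ((Real.toNNReal (Real.pi⁻¹ * (1 + s ^ 2)⁻¹) : ℝ≥0) : ℝ≥0∞) := by
  rw [ProbabilityTheory.cauchyMeasure_of_scale_ne_zero _ one_ne_zero]
  congr 1
  ext s
  simp only [ProbabilityTheory.cauchyPDF, ProbabilityTheory.cauchyPDFReal_def, ENNReal.ofReal]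
  simp [add_comm]

lemma poissonKernel_identity {x y : ℝ} (hy : 0 < y) (s : ℝ) :
    (2 * Real.pi * I)⁻¹ * ((((x + y * s : ℝ) : ℂ) - (x + y * I))⁻¹ -
      (((x + y * s : ℝ) : ℂ) - (x - y * I))⁻¹) =
      (y : ℂ)⁻¹ * ((Real.pi⁻¹ * (1 + s ^ 2)⁻¹ : ℝ) : ℂ) := by
  have h1 := ofReal_sub_I_ne_zero s
  have h2 := ofReal_add_I_ne_zero s
  have hy' : (y : ℂ) ≠ 0 := ofReal_ne_zero.2 hy.ne'
  have hpi : (Real.pi : ℂ) ≠ 0 := ofReal_ne_zero.2 Real.pi_ne_zero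
  have e1 : (((x + y * s : ℝ) : ℂ) - (x + y * I)) = y * (s - I) := by push_cast; ring
  have e2 : (((x + y * s : ℝ) : ℂ) - (x - y * I)) = y * (s + I) := by push_cast; ring
  have e3 : (1 + (s : ℂ) ^ 2) = (s - I) * (s + I) := by
    ring_nf; simp; ring
  rw [e1, e2]
  push_cast
  rw [e3]
  field_simp
  ring

lemma integrable_cauchyMeasure {f : ℝ → ℂ} {t : ℝ≥0∞} (ht : 1 ≤ t) (ht' : t ≠ ∞)
    (hL : MemLp f t volume) {y : ℝ} (hy : 0 < y) (x : ℝ) :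
    Integrable (fun s => f (x + y * s)) (ProbabilityTheory.cauchyMeasure 0 1) := by
  rw [cauchyMeasure_zero_one, integrable_withDensity_iff_integrable_smul (by fun_prop)]
  have h1 := (integrable_mul_inv_sub ht ht' hL (w := x + y * I) (by simp [hy.ne'])).sub
    (integrable_mul_inv_sub ht ht' hL (w := x - y * I) (by simp [hy.ne']))
  have h2 := (((h1.comp_add_left x).comp_mul_left' hy.ne').const_mul (2 * Real.pi * I)⁻¹).const_mul
    (y : ℂ)
  refine h2.congr (ae_of_all _ fun s => ?_)
  have h3 := poissonKernel_identity (x := x) hy s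
  have hy' : (y : ℂ) ≠ 0 := ofReal_ne_zero.2 hy.ne'
  simp only [Pi.sub_apply, NNReal.smul_def, real_smul]
  rw [← mul_sub, mul_left_comm _ (f _), h3, Real.coe_toNNReal _ (by positivity)]
  field_simp

/-- The jump of the Cauchy integral between conjugate points is the Poisson integral. -/
lemma lineCauchy_sub {f : ℝ → ℂ} {t : ℝ≥0∞} (ht : 1 ≤ t) (ht' : t ≠ ∞)
    (hL : MemLp f t volume) {y : ℝ} (hy : 0 < y) (x : ℝ) :
    lineCauchy f (x + y * I) - lineCauchy f (x - y * I) = poissonInt f y x := by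
  have h1 := integrable_mul_inv_sub ht ht' hL (w := x + y * I) (by simp [hy.ne'])
  have h2 := integrable_mul_inv_sub ht ht' hL (w := x - y * I) (by simp [hy.ne'])
  have hy' : (y : ℂ) ≠ 0 := ofReal_ne_zero.2 hy.ne'
  rw [lineCauchy, lineCauchy, ← mul_sub, ← integral_sub h1 h2, ← integral_const_mul, poissonInt,
    cauchyMeasure_zero_one, integral_withDensity_eq_integral_smul (by fun_prop)]
  set G : ℝ → ℂ := fun u => (2 * Real.pi * I)⁻¹ * (f u * ((u : ℂ) - (x + y * I))⁻¹ -
    f u * ((u : ℂ) - (x - y * I))⁻¹) with hG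
  have h3 : ∫ u, G u = y * ∫ s, G (x + y * s) := by
    rw [Measure.integral_comp_mul_left (fun s => G (x + s)), integral_add_left_eq_self G x,
      abs_of_pos (inv_pos.2 hy), real_smul, ofReal_inv, mul_inv_cancel_left₀ hy']
  rw [h3, ← integral_const_mul]
  refine integral_congr_ae (ae_of_all _ fun s => ?_)
  have h4 := poissonKernel_identity (x := x) hy s
  simp only [hG, NNReal.smul_def, real_smul]
  rw [← mul_sub, mul_left_comm _ (f _), h4, Real.coe_toNNReal _ (by positivity)]
  field_simp

lemma MemHardyPlus.integral_mul_inv_sub {f : ℝ → ℂ} {t : ℝ≥0∞} (ht : 1 ≤ t) (ht' : t ≠ ∞)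
    (hf : MemHardyPlus t f) {w : ℂ} (hw : w.im < 0) : ∫ u : ℝ, f u * ((u : ℂ) - w)⁻¹ = 0 := by
  have : Fact (1 ≤ t) := ⟨ht⟩
  have h1 : 1 < ENNReal.conjExponent t :=
    (ENNReal.HolderConjugate.lt_top_iff_one_lt t (ENNReal.conjExponent t)).1 ht'.lt_top
  exact (hf.mul (memHardyPlus_inv_sub hw h1) (t := 1)).integral_eq_zero

lemma MemHardyMinus.integral_mul_inv_sub {f : ℝ → ℂ} {t : ℝ≥0∞} (ht : 1 ≤ t) (ht' : t ≠ ∞)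
    (hf : MemHardyMinus t f) {w : ℂ} (hw : 0 < w.im) : ∫ u : ℝ, f u * ((u : ℂ) - w)⁻¹ = 0 := by
  have : Fact (1 ≤ t) := ⟨ht⟩
  have h1 : 1 < ENNReal.conjExponent t :=
    (ENNReal.HolderConjugate.lt_top_iff_one_lt t (ENNReal.conjExponent t)).1 ht'.lt_top
  exact (hf.mul (memHardyMinus_inv_sub hw h1) (t := 1)).integral_eq_zero

/-- A function of `L_t` whose Cauchy integral vanishes in the lower half plane belongs to `H_t^+`:
its Cauchy integral in the upper half plane is its Poisson integral. -/
lemma memHardyPlus_of_integral_eq_zero {f : ℝ → ℂ} {t : ℝ≥0∞} (ht : 1 ≤ t) (ht' : t ≠ ∞)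
    (hL : MemLp f t volume) (h : ∀ w : ℂ, w.im < 0 → ∫ u : ℝ, f u * ((u : ℂ) - w)⁻¹ = 0) :
    MemHardyPlus t f := by
  wlog hm : StronglyMeasurable f generalizing f
  · have hmk := hL.1.ae_eq_mk
    refine (this (hL.ae_eq hmk) (fun w hw => ?_) hL.1.stronglyMeasurable_mk).congr hmk.symm
    rw [← h w hw]
    refine integral_congr_ae ?_
    filter_upwards [hmk] with u hu
    rw [hu]
  have key : ∀ y : ℝ, 0 < y → ∀ x : ℝ, lineCauchy f (x + y * I) = poissonInt f y x := by
    intro y hy x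
    rw [← lineCauchy_sub ht ht' hL hy x, lineCauchy, lineCauchy, h (x - y * I) (by simpa using hy),
      mul_zero, sub_zero]
  refine ⟨hL, lineCauchy f, fun z hz => (differentiableAt_lineCauchy ht ht' hL
    (ne_of_gt hz)).differentiableWithinAt, ⟨(eLpNorm f t volume).toNNReal, fun y hy => ?_⟩, ?_⟩
  · rw [ENNReal.coe_toNNReal hL.2.ne]
    simp only [key y hy]
    exact eLpNorm_poissonInt_le hm ht ht' y
  · refine (tendsto_poissonInt_sub hm ht ht' hL
      fun y hy x => integrable_cauchyMeasure ht ht' hL hy x).congr' ?_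
    filter_upwards [self_mem_nhdsWithin] with y hy
    simp only [key y hy]

/-- `H_t^+ ∩ H_t^- = 0`. -/
lemma MemHardyPlus.eq_zero_of_minus {f : ℝ → ℂ} {t : ℝ≥0∞} (ht : 1 ≤ t) (ht' : t ≠ ∞)
    (hp : MemHardyPlus t f) (hn : MemHardyMinus t f) : f =ᵐ[volume] 0 := by
  wlog hm : StronglyMeasurable f generalizing f
  · have hmk := hp.1.1.ae_eq_mk
    exact hmk.trans (this (hp.congr hmk) (hn.congr hmk) hp.1.1.stronglyMeasurable_mk)
  have hL := hp.1
  have key : ∀ y : ℝ, 0 < y → ∀ x : ℝ, poissonInt f y x = 0 := by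
    intro y hy x
    rw [← lineCauchy_sub ht ht' hL hy x, lineCauchy, lineCauchy,
      hp.integral_mul_inv_sub ht ht' (w := x - y * I) (by simpa using hy),
      hn.integral_mul_inv_sub ht ht' (w := x + y * I) (by simpa using hy), sub_self]
  have h1 := tendsto_poissonInt_sub hm ht ht' hL
      fun y hy x => integrable_cauchyMeasure ht ht' hL hy x
  have h2 : eLpNorm f t volume = 0 := by
    refine tendsto_nhds_unique (tendsto_const_nhds.congr' ?_) h1
    filter_upwards [self_mem_nhdsWithin] with y hy
    simp only [key y hy, zero_sub]
    exact (eLpNorm_neg f t volume).symm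
  exact (eLpNorm_eq_zero_iff hL.1 (zero_lt_one.trans_le ht).ne').1 h2

/-! ### Removing a zero at `i`, and a Liouville theorem -/

lemma eLpNorm_le_of_norm_le_add {p : ℝ≥0∞} (hp : 1 ≤ p) {E₁ E₂ E₃ : Type*}
    [NormedAddCommGroup E₁] [NormedAddCommGroup E₂] [NormedAddCommGroup E₃]
    {u : ℝ → E₁} {v : ℝ → E₂} {w : ℝ → E₃} {a b : ℝ}
    (ha : 0 ≤ a) (hb : 0 ≤ b) (hv : AEStronglyMeasurable v volume)
    (hw : AEStronglyMeasurable w volume) (h : ∀ x, ‖u x‖ ≤ a * ‖v x‖ + b * ‖w x‖) :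
    eLpNorm u p volume ≤
      ENNReal.ofReal a * eLpNorm v p volume + ENNReal.ofReal b * eLpNorm w p volume := by
  set v' : ℝ → ℝ := fun x => a * ‖v x‖ with hv'
  set w' : ℝ → ℝ := fun x => b * ‖w x‖ with hw'
  have h1 : eLpNorm u p volume ≤ eLpNorm (v' + w') p volume := by
    refine eLpNorm_mono_real fun x => ?_
    simpa [hv', hw'] using h x
  have h2 : eLpNorm v' p volume ≤ ENNReal.ofReal a * eLpNorm v p volume := by
    refine eLpNorm_le_mul_eLpNorm_of_ae_le_mul (ae_of_all _ fun x => ?_) p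
    rw [hv', Real.norm_of_nonneg (by positivity)]
  have h3 : eLpNorm w' p volume ≤ ENNReal.ofReal b * eLpNorm w p volume := by
    refine eLpNorm_le_mul_eLpNorm_of_ae_le_mul (ae_of_all _ fun x => ?_) p
    rw [hw', Real.norm_of_nonneg (by positivity)]
  exact h1.trans ((eLpNorm_add_le (hv.norm.const_mul a) (hw.norm.const_mul b) hp).trans
    (add_le_add h2 h3))

lemma tendsto_zero_of_norm_le {p : ℝ≥0∞} (hp : 1 ≤ p) {u v : ℝ → ℝ → ℂ} {f : ℝ → ℂ} {a b : ℝ}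
    (ha : 0 ≤ a) (hv : ∀ y, 0 < y → AEStronglyMeasurable (v y) volume) (hf : MemLp f p volume) (hb : 0 ≤ b)
    (hvt : Tendsto (fun y => eLpNorm (v y) p volume) (𝓝[>] 0) (𝓝 0))
    (hle : ∀ᶠ y : ℝ in 𝓝[>] 0, ∀ x, ‖u y x‖ ≤ a * ‖v y x‖ + b * y * ‖f x‖) :
    Tendsto (fun y => eLpNorm (u y) p volume) (𝓝[>] (0 : ℝ)) (𝓝 0) := by
  have h1 : Tendsto (fun y : ℝ => ENNReal.ofReal a * eLpNorm (v y) p volume +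
      ENNReal.ofReal (b * y) * eLpNorm f p volume) (𝓝[>] 0) (𝓝 0) := by
    have h2 : Tendsto (fun y : ℝ => ENNReal.ofReal (b * y)) (𝓝[>] 0) (𝓝 0) := by
      have : Continuous (fun y : ℝ => ENNReal.ofReal (b * y)) :=
        ENNReal.continuous_ofReal.comp (by fun_prop)
      simpa using (this.tendsto 0).mono_left nhdsWithin_le_nhds
    simpa using (ENNReal.Tendsto.const_mul hvt (Or.inr (ENNReal.ofReal_ne_top (r := a)))).add
      (ENNReal.Tendsto.mul_const h2 (Or.inr hf.2.ne))
  refine tendsto_of_tendsto_of_tendsto_of_le_of_le' tendsto_const_nhds h1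
    (Eventually.of_forall fun _ => zero_le) ?_
  filter_upwards [self_mem_nhdsWithin, hle] with y hy hley
  have hy' : 0 < y := hy
  have h3 := eLpNorm_le_of_norm_le_add hp ha (b := b * y) (by positivity) (hv y hy) hf.1 hley
  exact h3

/-- If the extension of `f ∈ H_t^+` vanishes at `i`, then `f / r ∈ H_t^+`. -/
lemma memHardyPlus_mul_rFun_inv {f : ℝ → ℂ} {t : ℝ≥0∞} (ht : 1 ≤ t) (h0 : MemLp f t volume)
    {F : ℂ → ℂ} (hF : DifferentiableOn ℂ F {z : ℂ | 0 < z.im}) {C : ℝ≥0}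
    (hC : ∀ y : ℝ, 0 < y →
      eLpNorm (fun x : ℝ => F ((x : ℂ) + (y : ℂ) * I)) t volume ≤ C)
    (hlim : Tendsto (fun y : ℝ => eLpNorm (fun x : ℝ => F ((x : ℂ) + (y : ℂ) * I) - f x) t volume)
      (𝓝[>] 0) (𝓝 0)) (hFI : F I = 0) :
    MemHardyPlus t (fun x => f x * (rFun x)⁻¹) := by
  have mF : ∀ y : ℝ, 0 < y →
      AEStronglyMeasurable (fun x : ℝ => F ((x : ℂ) + (y : ℂ) * I)) volume := fun y hy =>
    aesm_of_diffOn hF _ (by fun_prop) (by simpa using hy)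
  have hopen : IsOpen {z : ℂ | 0 < z.im} := isOpen_lt continuous_const continuous_im
  set G : ℂ → ℂ := fun z => dslope F I z * (z + I) with hG
  have hGd : DifferentiableOn ℂ G {z : ℂ | 0 < z.im} :=
    ((differentiableOn_dslope (hopen.mem_nhds (by simp))).2 hF).mul (by fun_prop)
  have hGe : ∀ z, z ≠ I → G z = F z * (1 + 2 * I * (z - I)⁻¹) := fun z hz => by
    have := sub_ne_zero.2 hz
    simp only [hG, dslope_of_ne F hz, slope_def_field, hFI, sub_zero]
    field_simp
    ring
  have hm5 : ∀ z, 1 / 2 ≤ ‖z - I‖ → ‖1 + 2 * I * (z - I)⁻¹‖ ≤ 5 := fun z hz => by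
    refine (norm_add_le _ _).trans ?_
    have h1 : ‖z - I‖⁻¹ ≤ 2 := by
      rw [inv_le_comm₀ (by linarith) (by norm_num)]; linarith
    simp only [norm_one, norm_mul, norm_inv, norm_I, mul_one, Complex.norm_ofNat]
    linarith
  have hne : ∀ z, 1 / 2 ≤ ‖z - I‖ → z ≠ I := fun z hz h => by
    rw [h, sub_self, norm_zero] at hz; norm_num at hz
  obtain ⟨M, hM⟩ := (isCompact_closedBall I (1 / 2)).exists_bound_of_continuousOn
    (hGd.continuousOn.mono fun z hz => by
      have h1 := (Complex.abs_im_le_norm (z - I)).trans (mem_closedBall_iff_norm.1 hz)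
      rw [sub_im, I_im] at h1
      have := (abs_le.1 h1).1
      show 0 < z.im
      linarith)
  have hM0 : 0 ≤ M := (norm_nonneg _).trans (hM I (Metric.mem_closedBall_self (by norm_num)))
  have hr : MemLp (fun x => f x * (rFun x)⁻¹) t volume := by
    have := (memHardyMinus_rFun_inv_pow 1).1
    simp only [pow_one] at this
    exact this.mul' h0
  refine ⟨hr, G, hGd, ?_, ?_⟩
  · have hI : MemLp (Set.indicator (Set.Icc (-1 : ℝ) 1) fun _ => M) t volume :=
      memLp_indicator_const t measurableSet_Icc M (Or.inr (by simp))
    refine ⟨(ENNReal.ofReal 5).toNNReal * C + (ENNReal.ofReal 1).toNNReal *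
      (eLpNorm (Set.indicator (Set.Icc (-1 : ℝ) 1) fun _ => M) t volume).toNNReal,
      fun y hy => ?_⟩
    push_cast
    rw [ENNReal.coe_toNNReal hI.2.ne, ENNReal.coe_toNNReal ENNReal.ofReal_ne_top,
      ENNReal.coe_toNNReal ENNReal.ofReal_ne_top]
    refine (eLpNorm_le_of_norm_le_add ht (by norm_num) zero_le_one (mF y hy) hI.1
      fun x => ?_).trans (add_le_add_left (mul_le_mul_right (hC y hy) _) _)
    have hind : 0 ≤ Set.indicator (Set.Icc (-1 : ℝ) 1) (fun _ => M) x :=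
      Set.indicator_nonneg (fun _ _ => hM0) x
    rw [Real.norm_of_nonneg hind, one_mul]
    rcases le_total (1 / 2) ‖(x : ℂ) + (y : ℂ) * I - I‖ with h | h
    · rw [hGe _ (hne _ h), norm_mul, mul_comm]
      have := mul_le_mul_of_nonneg_right (hm5 _ h) (norm_nonneg (F (x + y * I)))
      linarith
    · have hx : x ∈ Set.Icc (-1 : ℝ) 1 := by
        have := (Complex.abs_re_le_norm _).trans h
        simp at this
        have := abs_le.1 this
        constructor <;> linarith [this.1, this.2]
      rw [Set.indicator_of_mem hx]
      have := hM _ (mem_closedBall_iff_norm.2 h)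
      linarith [norm_nonneg (F (x + y * I))]
  · refine tendsto_zero_of_norm_le ht (a := 5) (b := 4) (f := f) (by norm_num)
      (v := fun y x => F ((x : ℂ) + (y : ℂ) * I) - f x) (fun y hy => (mF y hy).sub h0.1) h0
      (by norm_num) hlim ?_
    filter_upwards [self_mem_nhdsWithin,
      mem_nhdsWithin_of_mem_nhds (Iio_mem_nhds (show (0 : ℝ) < 1 / 2 by norm_num))] with y hy hy2 x
    have hy' : 0 < y := hy
    have hy2' : y < 1 / 2 := hy2
    have h1 : 1 / 2 ≤ ‖(x : ℂ) + y * I - I‖ := by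
      have := Complex.abs_im_le_norm ((x : ℂ) + y * I - I)
      simp at this
      have h3 : 1 / 2 ≤ |y - 1| := by rw [abs_sub_comm]; exact le_trans (by linarith) (le_abs_self _)
      linarith
    have h2 : 1 ≤ ‖(x : ℂ) - I‖ := by
      simpa using Complex.abs_im_le_norm ((x : ℂ) - I)
    have n1 := sub_ne_zero.2 (hne _ h1)
    have n2 := ofReal_sub_I_ne_zero x
    have e : G (x + y * I) - f x * (rFun x)⁻¹ =
        (1 + 2 * I * ((x : ℂ) + y * I - I)⁻¹) * (F (x + y * I) - f x) +
        (2 * y * ((x : ℂ) + y * I - I)⁻¹ * ((x : ℂ) - I)⁻¹) * f x := by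
      have e1 : ((x : ℂ) + y * I - I)⁻¹ - ((x : ℂ) - I)⁻¹ =
        -(y * I) * ((x : ℂ) + y * I - I)⁻¹ * ((x : ℂ) - I)⁻¹ := by
        field_simp
        ring
      rw [hGe _ (hne _ h1), rFun_inv_eq]
      linear_combination (2 * I * f x) * e1 -
        (2 * y * ((x : ℂ) + y * I - I)⁻¹ * ((x : ℂ) - I)⁻¹ * f x) * I_sq
    rw [e]
    refine (norm_add_le _ _).trans (add_le_add ?_ ?_)
    · rw [norm_mul]
      gcongr
      exact hm5 _ h1
    · simp only [norm_mul, norm_inv, norm_real, Complex.norm_ofNat, Real.norm_of_nonneg hy'.le]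
      have h3 : ‖(x : ℂ) + y * I - I‖⁻¹ ≤ 2 := by
        rw [inv_le_comm₀ (by linarith) (by norm_num)]; linarith
      have h4 : ‖(x : ℂ) - I‖⁻¹ ≤ 1 := inv_le_one_of_one_le₀ h2
      have : 2 * y * ‖(x : ℂ) + y * I - I‖⁻¹ * ‖(x : ℂ) - I‖⁻¹ ≤ 2 * y * 2 * 1 := by gcongr
      calc _ ≤ (2 * y * 2 * 1) * ‖f x‖ := by gcongr
        _ = _ := by ring

/-- If `e ∈ H_t^+` is not divisible by `r`, then every `f ∈ H_t^+` is divisible by `r` up to a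
multiple of `e`. -/
lemma MemHardyPlus.exists_sub_mul_rFun_inv {f e : ℝ → ℂ} {t : ℝ≥0∞} (ht : 1 ≤ t)
    (hf : MemHardyPlus t f) (he : MemHardyPlus t e)
    (hne : ¬ MemHardyPlus t (fun x => e x * (rFun x)⁻¹)) :
    ∃ c : ℂ, MemHardyPlus t (fun x => (f x - c * e x) * (rFun x)⁻¹) := by
  obtain ⟨e0, E, hE, ⟨D, hD⟩, et⟩ := he
  obtain ⟨f0, F, hF, ⟨C, hC⟩, ft⟩ := hf
  have hEI : E I ≠ 0 := fun h => hne (memHardyPlus_mul_rFun_inv ht e0 hE hD et h)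
  have mF : ∀ y : ℝ, 0 < y →
      AEStronglyMeasurable (fun x : ℝ => F ((x : ℂ) + (y : ℂ) * I)) volume := fun y hy =>
    aesm_of_diffOn hF _ (by fun_prop) (by simpa using hy)
  have mE : ∀ y : ℝ, 0 < y →
      AEStronglyMeasurable (fun x : ℝ => E ((x : ℂ) + (y : ℂ) * I)) volume := fun y hy =>
    aesm_of_diffOn hE _ (by fun_prop) (by simpa using hy)
  set c := F I / E I with hc
  obtain ⟨K, hK⟩ := bdd_eLpNorm_add (p := t) mF (fun y hy => (mE y hy).const_smul (-c)) ⟨C, hC⟩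
    (bdd_eLpNorm_smul (-c) ⟨D, hD⟩)
  refine ⟨c, memHardyPlus_mul_rFun_inv ht (f0.sub (e0.const_mul c)) (F := fun z => F z - c * E z)
    (hF.sub (hE.const_mul c)) (C := K) (fun y hy => ?_) ?_ ?_⟩
  · refine le_of_eq_of_le ?_ (hK y hy)
    congr 1
    ext x
    simp [sub_eq_add_neg]
  · refine (tendsto_eLpNorm_add (fun y hy => (mF y hy).sub f0.1)
      (fun y hy => ((mE y hy).sub e0.1).const_smul (-c)) ft
      (tendsto_eLpNorm_smul (-c) et)).congr fun y => ?_
    congr 1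
    ext x
    simp only [Pi.add_apply, Pi.sub_apply, Pi.smul_apply, smul_eq_mul]
    ring
  · simp [hc, hEI]

lemma memHardyPlus_inv_add_I_sq : MemHardyPlus 1 (fun x : ℝ => ((x : ℂ) + I)⁻¹ ^ 2) := by
  have h := memHardyPlus_inv_add_I (s := 2) (by norm_num)
  simpa [sq] using h.mul h (t := 1)

lemma integral_inv_add_I_sq_mul :
    ∫ x : ℝ, ((x : ℂ) + I)⁻¹ ^ 2 * (rFun x)⁻¹ = (Real.pi : ℂ) := by
  rw [← integral_univ_inv_one_add_sq, ← integral_complex_ofReal]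
  refine integral_congr_ae (ae_of_all _ fun x => ?_)
  have h1 := ofReal_sub_I_ne_zero x
  have h2 := ofReal_add_I_ne_zero x
  have e3 : (1 + (x : ℂ) ^ 2) = (x - I) * (x + I) := by
    ring_nf; simp; ring
  simp only [rFun]
  push_cast
  rw [e3]
  field_simp

lemma not_memHardyPlus_inv_add_I_sq :
    ¬ MemHardyPlus 1 (fun x : ℝ => ((x : ℂ) + I)⁻¹ ^ 2 * (rFun x)⁻¹) := fun h => by
  have h1 := h.integral_eq_zero
  rw [integral_inv_add_I_sq_mul] at h1
  exact Real.pi_ne_zero (ofReal_eq_zero.1 h1)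

lemma inv_add_I_eq (x : ℝ) : ((x : ℂ) + I)⁻¹ = rFun x * ((x : ℂ) - I)⁻¹ := by
  have h1 := ofReal_sub_I_ne_zero x
  have h2 := ofReal_add_I_ne_zero x
  rw [rFun]
  field_simp

/-- A function that is in `H_1^+` and becomes a function of `H_1^-` after division by `r^n` is a
rational function with a pole at `-i` only (and zero for `n ≤ 1`). Each step subtracts a multiple of
`1 / (x + i)²` from `B` and divides by `r`, as `1 / (x + i)` is not in `L_1`. In the case `n = 1` one has `∫ A = 0`, and hence the
extension of `B = rA` vanishes at `i`. -/
lemma exists_eq_sum_of_eq_rFun_pow_mul (n : ℕ) {A B : ℝ → ℂ} (hA : MemHardyMinus 1 A)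
    (hB : MemHardyPlus 1 B) (h : B =ᵐ[volume] fun x => rFun x ^ n * A x) :
    ∃ c : ℕ → ℂ, B =ᵐ[volume] fun x =>
      (∑ j ∈ Finset.range (n - 1), c j * rFun x ^ j) * ((x : ℂ) + I)⁻¹ ^ 2 := by
  obtain ⟨c, hc⟩ := hB.exists_sub_mul_rFun_inv le_rfl memHardyPlus_inv_add_I_sq
    not_memHardyPlus_inv_add_I_sq
  induction n generalizing A B c with
  | zero =>
    refine ⟨0, ?_⟩
    simpa using! hB.eq_zero_of_minus le_rfl (by simp) (hA.congr (by simpa using h.symm))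
  | succ n ih =>
    rcases Nat.eq_zero_or_pos n with rfl | hn
    · refine ⟨0, ?_⟩
      have hAB : A =ᵐ[volume] fun x => B x * (rFun x)⁻¹ := by
        filter_upwards [h] with x hx
        have := rFun_ne_zero x
        rw [hx, zero_add, pow_one]
        field_simp
      have h1 := hc.integral_eq_zero
      have i1 : Integrable A := memLp_one_iff_integrable.1 hA.1
      have i2 : Integrable fun x : ℝ => ((x : ℂ) + I)⁻¹ ^ 2 * (rFun x)⁻¹ := by
        refine Integrable.of_integral_ne_zero ?_
        rw [integral_inv_add_I_sq_mul]
        exact ofReal_ne_zero.2 Real.pi_ne_zero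
      have h2 : ∫ x : ℝ, (B x - c * ((x : ℂ) + I)⁻¹ ^ 2) * (rFun x)⁻¹ =
          (∫ x, A x) - c * ∫ x : ℝ, ((x : ℂ) + I)⁻¹ ^ 2 * (rFun x)⁻¹ := by
        rw [← integral_const_mul, ← integral_sub i1 (i2.const_mul c)]
        refine integral_congr_ae ?_
        filter_upwards [hAB] with x hx
        rw [hx]
        ring
      rw [h2, hA.integral_eq_zero, integral_inv_add_I_sq_mul, zero_sub, neg_eq_zero,
        mul_eq_zero, or_iff_left (ofReal_ne_zero.2 Real.pi_ne_zero)] at h1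
      subst h1
      have h3 : A =ᵐ[volume] 0 :=
        (hc.congr (by filter_upwards [hAB] with x hx; rw [hx]; ring)).eq_zero_of_minus le_rfl
          (by simp) hA
      filter_upwards [h, h3] with x hx hx3
      simp [hx, hx3]
    · obtain ⟨m, rfl⟩ : ∃ m, n = m + 1 := ⟨n - 1, by omega⟩
      have hA' : MemHardyMinus 1 fun x : ℝ => A x -
          c * ((rFun x)⁻¹ ^ m * (((x : ℂ) - I)⁻¹ * ((x : ℂ) - I)⁻¹)) := by
        have h2 := memHardyMinus_inv_sub_I (s := 2) (by norm_num)
        exact hA.sub (((memHardyMinus_rFun_inv_pow m).mul (h2.mul h2 (t := 1)) (t := 1)).const_mul c)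
      obtain ⟨c'', hc''⟩ := hc.exists_sub_mul_rFun_inv le_rfl memHardyPlus_inv_add_I_sq
        not_memHardyPlus_inv_add_I_sq
      obtain ⟨c', hc'⟩ := ih hA' hc (by
        filter_upwards [h] with x hx
        have h0 := mul_inv_cancel₀ (rFun_ne_zero x)
        have h1 : rFun x ^ m * (rFun x)⁻¹ ^ m = 1 := by rw [← mul_pow, h0, one_pow]
        rw [hx, inv_add_I_eq]
        linear_combination (rFun x ^ (m + 1) * A x - c * rFun x * ((x : ℂ) - I)⁻¹ ^ 2) * h0 +
          c * rFun x * ((x : ℂ) - I)⁻¹ ^ 2 * h1) c'' hc''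
      refine ⟨fun j => if j = 0 then c else c' (j - 1), ?_⟩
      filter_upwards [hc'] with x hx
      have h0 := rFun_ne_zero x
      have h4 : B x = (B x - c * ((x : ℂ) + I)⁻¹ ^ 2) * (rFun x)⁻¹ * rFun x +
        c * ((x : ℂ) + I)⁻¹ ^ 2 := by
        field_simp
        ring
      rw [h4, hx]
      simp only [Nat.add_sub_cancel, Finset.sum_range_succ', pow_succ, ← mul_assoc,
        ← Finset.sum_mul]
      simp
      ring

lemma not_memHardyPlus_inv_add_I_mul {t : ℝ≥0∞} (ht : 1 < t) (ht' : t ≠ ∞) :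
    ¬ MemHardyPlus t (fun x : ℝ => ((x : ℂ) + I)⁻¹ * (rFun x)⁻¹) := fun h => by
  have e : ∀ x : ℝ, ((x : ℂ) + I)⁻¹ * (rFun x)⁻¹ = ((x : ℂ) - I)⁻¹ := fun x => by
    have := rFun_ne_zero x
    rw [inv_add_I_eq]
    field_simp
  simp only [e] at h
  obtain ⟨x, hx⟩ := (h.eq_zero_of_minus ht.le ht' (memHardyMinus_inv_sub_I ht)).exists
  exact inv_ne_zero (ofReal_sub_I_ne_zero x) hx

/-! ### Riesz decomposition of rapidly decaying functions -/

lemma norm_pow_sub_pow_le_mul (w v : ℂ) {R : ℝ} (hw : ‖w‖ ≤ R) (hv : ‖v‖ ≤ R) (m : ℕ) :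
    ‖w ^ (m + 1) - v ^ (m + 1)‖ ≤ (m + 1) * (‖w - v‖ * R ^ m) := by
  have hR : 0 ≤ R := (norm_nonneg w).trans hw
  induction m with
  | zero => simp
  | succ m ih =>
    have e : w ^ (m + 1 + 1) - v ^ (m + 1 + 1) =
        w * (w ^ (m + 1) - v ^ (m + 1)) + (w - v) * v ^ (m + 1) := by ring
    rw [e]
    calc _ ≤ ‖w‖ * ‖w ^ (m + 1) - v ^ (m + 1)‖ + ‖w - v‖ * ‖v‖ ^ (m + 1) := by
          refine (norm_add_le _ _).trans ?_
          rw [norm_mul, norm_mul, norm_pow]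
      _ ≤ R * ((m + 1) * (‖w - v‖ * R ^ m)) + ‖w - v‖ * R ^ (m + 1) := by gcongr
      _ = _ := by push_cast; ring

/-- The pointwise inequality behind the `L_{2m}` estimate: where `|z|` is not controlled by `Re z`,
the power `z^{2m}` is close to `(-1)^m |z|^{2m}`, because `z² + |z|² = 2 z Re z`. -/
lemma norm_pow_le_re_pow_add (m : ℕ) (z : ℂ) :
    ‖z‖ ^ (2 * (m + 1)) ≤ 3 * (4 * (m + 1)) ^ (2 * (m + 1)) * |z.re| ^ (2 * (m + 1)) +
      2 * ((-1) ^ (m + 1) * (z ^ (2 * (m + 1))).re) := by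
  have hnz := norm_nonneg z
  rcases le_total (4 * (m + 1) * |z.re|) ‖z‖ with h | h
  · have e1 : z ^ 2 - -((‖z‖ ^ 2 : ℝ) : ℂ) = 2 * z.re * z := by
      rw [← normSq_eq_norm_sq, normSq_eq_conj_mul_self]
      have := Complex.add_conj z
      push_cast at this
      linear_combination z * this
    have h1 := norm_pow_sub_pow_le_mul (z ^ 2) (-((‖z‖ ^ 2 : ℝ) : ℂ)) (R := ‖z‖ ^ 2)
      (by rw [norm_pow]) (by rw [norm_neg, norm_real]; simp) m
    rw [e1, norm_mul, norm_mul, norm_real, Complex.norm_ofNat, Real.norm_eq_abs] at h1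
    have e2 : (-((‖z‖ ^ 2 : ℝ) : ℂ)) ^ (m + 1) = (-1) ^ (m + 1) * ((‖z‖ ^ (2 * (m + 1)) : ℝ) : ℂ) := by
      rw [neg_pow, pow_mul]; push_cast; ring
    have h2 : ‖z‖ ^ (2 * (m + 1)) - (-1) ^ (m + 1) * (z ^ (2 * (m + 1))).re ≤
        ‖(z ^ 2) ^ (m + 1) - (-((‖z‖ ^ 2 : ℝ) : ℂ)) ^ (m + 1)‖ := by
      rw [← pow_mul, e2]
      have h3 : ((-1 : ℂ)) ^ (m + 1) = (((-1) ^ (m + 1) : ℝ) : ℂ) := by push_cast; ring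
      refine le_trans ?_ (Complex.abs_re_le_norm _)
      rw [h3, ← ofReal_mul, sub_re, ofReal_re]
      rcases neg_one_pow_eq_or ℝ (m + 1) with h4 | h4 <;> rw [h4]
      · rw [abs_sub_comm]
        exact le_trans (by linarith) (le_abs_self _)
      · exact le_trans (by linarith) (le_abs_self _)
    have h3 : (m + 1) * (2 * |z.re| * ‖z‖ * (‖z‖ ^ 2) ^ m) ≤ 1 / 2 * ‖z‖ ^ (2 * (m + 1)) := by
      calc _ = 1 / 2 * (4 * (m + 1) * |z.re|) * (‖z‖ * (‖z‖ ^ 2) ^ m) := by ring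
        _ ≤ 1 / 2 * ‖z‖ * (‖z‖ * (‖z‖ ^ 2) ^ m) := by gcongr
        _ = _ := by rw [← pow_mul]; ring
    have h4 : 0 ≤ 3 * (4 * ((m : ℝ) + 1)) ^ (2 * (m + 1)) * |z.re| ^ (2 * (m + 1)) := by positivity
    linarith
  -- here `‖z‖ ≤ 4 (m + 1) |Re z|`; the factor `3` absorbs the term `2 ‖z‖^{2m}`
  · have h1 : ‖z‖ ^ (2 * (m + 1)) ≤ (4 * (m + 1)) ^ (2 * (m + 1)) * |z.re| ^ (2 * (m + 1)) := by
      rw [← mul_pow]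
      gcongr
    have h2 : -‖z‖ ^ (2 * (m + 1)) ≤ (-1) ^ (m + 1) * (z ^ (2 * (m + 1))).re := by
      have h3 := abs_le.1 (Complex.abs_re_le_norm (z ^ (2 * (m + 1))))
      rw [norm_pow] at h3
      rcases neg_one_pow_eq_or ℝ (m + 1) with h4 | h4 <;> rw [h4] <;> linarith [h3.1, h3.2]
    linarith

lemma eLpNorm_le_eLpNorm_re (m : ℕ) : ∃ K : ℝ≥0, ∀ v : ℝ → ℂ,
    MemLp v (2 * (m + 1) : ℕ) volume → ∫ x, v x ^ (2 * (m + 1)) = 0 →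
    eLpNorm v (2 * (m + 1) : ℕ) volume ≤
      K * eLpNorm (fun x => (v x).re) (2 * (m + 1) : ℕ) volume := by
  set n := 2 * (m + 1) with hn
  have hn0 : n ≠ 0 := by omega
  set K₀ : ℝ := 3 * (4 * (m + 1)) ^ n with hK₀
  have hK0 : 0 ≤ K₀ := by positivity
  refine ⟨(K₀ ^ ((n : ℝ)⁻¹)).toNNReal, fun v hv hint => ?_⟩
  have hp0 : ((n : ℕ) : ℝ≥0∞) ≠ 0 := by exact_mod_cast hn0
  have hpt : ((n : ℕ) : ℝ≥0∞) ≠ ∞ := ENNReal.natCast_ne_top n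
  have hre : MemLp (fun x => (v x).re) (n : ℝ≥0∞) volume := hv.re
  have i1 : Integrable fun x => ‖v x‖ ^ n := by
    have := hv.integrable_norm_rpow hp0 hpt
    simpa [Real.rpow_natCast] using this
  have i2 : Integrable fun x => |(v x).re| ^ n := by
    have := hre.integrable_norm_rpow hp0 hpt
    simpa [Real.rpow_natCast] using this
  have i3 : Integrable fun x => v x ^ n := by
    refine i1.mono (hv.1.pow n) (ae_of_all _ fun x => ?_)
    simp
  have h1 : ∫ x, ‖v x‖ ^ n ≤ K₀ * ∫ x, |(v x).re| ^ n := by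
    calc ∫ x, ‖v x‖ ^ n
        ≤ ∫ x, (K₀ * |(v x).re| ^ n + 2 * ((-1) ^ (m + 1) * (v x ^ n).re)) :=
          integral_mono i1 ((i2.const_mul _).add ((i3.re.const_mul _).const_mul _))
            fun x => norm_pow_le_re_pow_add m (v x)
      _ = K₀ * ∫ x, |(v x).re| ^ n := by
          have h2 : ∫ x, (v x ^ n).re = 0 := by
            have := integral_re i3
            simp only [RCLike.re_to_complex] at this
            rw [this, hint, zero_re]
          have i4 : Integrable fun x => (v x ^ n).re := i3.re
          rw [integral_add (i2.const_mul _) ((i4.const_mul _).const_mul _), integral_const_mul,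
            integral_const_mul, integral_const_mul, h2]
          simp
  rw [hv.eLpNorm_eq_integral_rpow_norm hp0 hpt, hre.eLpNorm_eq_integral_rpow_norm hp0 hpt]
  change _ ≤ ENNReal.ofReal _ * _
  rw [← ENNReal.ofReal_mul (by positivity)]
  apply ENNReal.ofReal_le_ofReal
  simp only [ENNReal.toReal_natCast, Real.rpow_natCast, Real.norm_eq_abs]
  rw [← Real.mul_rpow hK0 (integral_nonneg fun x => by positivity)]
  exact Real.rpow_le_rpow (integral_nonneg fun x => by positivity) h1 (by positivity)

lemma memLp_of_norm_le_inv_add_I {v : ℝ → ℂ} {D : ℝ} (hm : AEStronglyMeasurable v volume)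
    (hv : ∀ x : ℝ, ‖v x‖ ≤ D * ‖((x : ℂ) + I)⁻¹‖) {s : ℝ≥0∞} (hs : 1 < s) : MemLp v s volume :=
  (memHardyPlus_inv_add_I hs).1.of_le_mul hm (ae_of_all _ hv)

lemma integral_pow_eq_zero_of_norm_le {V : ℂ → ℂ} (hV : DifferentiableOn ℂ V {z : ℂ | 0 < z.im})
    {D : ℝ} (hD : ∀ x y : ℝ, 0 < y → ‖V (x + y * I)‖ ≤ D * ‖((x : ℂ) + I)⁻¹‖) (m : ℕ) {a : ℝ}
    (ha : 0 < a) : ∫ x : ℝ, V (x + a * I) ^ (2 * (m + 1)) = 0 := by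
  have hmem := memLp_of_norm_le_inv_add_I (v := fun x : ℝ => (D : ℂ) * ((x : ℂ) + I)⁻¹) (D := |D|)
    (((memHardyPlus_inv_add_I (s := 2) (by norm_num)).1.const_mul _).1)
    (fun x => by rw [norm_mul, norm_real, Real.norm_eq_abs]) (s := (2 * (m + 1) : ℕ))
    (by exact_mod_cast (show 1 < 2 * (m + 1) by omega))
  have h1 : MemLp (fun x : ℝ => ‖(D : ℂ) * ((x : ℂ) + I)⁻¹‖ ^ (2 * (m + 1))) 1 volume := by
    rw [memLp_one_iff_integrable]
    have := hmem.integrable_norm_rpow (by simp) (ENNReal.natCast_ne_top _)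
    simpa only [ENNReal.toReal_natCast, Real.rpow_natCast] using this
  refine integral_line_eq_zero (F := fun z => V z ^ (2 * (m + 1))) (hV.pow _)
    (C := (eLpNorm (fun x : ℝ => ‖(D : ℂ) * ((x : ℂ) + I)⁻¹‖ ^ (2 * (m + 1))) 1 volume).toNNReal)
    (fun y hy => ?_) ha
  rw [ENNReal.coe_toNNReal h1.2.ne]
  refine eLpNorm_mono fun x => ?_
  rw [norm_pow, norm_pow, norm_norm]
  gcongr
  refine (hD x y hy).trans ?_
  rw [norm_mul, norm_real]
  gcongr
  exact Real.le_norm_self D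

lemma norm_lineCauchy_le {h : ℝ → ℂ} (h1 : Integrable h)
    (h2 : Integrable fun u : ℝ => ((u : ℂ) + I) * h u) {b : ℝ} (hb : 0 < b) :
    ∃ D : ℝ, ∀ x y : ℝ, b ≤ y → ‖lineCauchy h (x + y * I)‖ ≤ D * ‖((x : ℂ) + I)⁻¹‖ := by
  refine ⟨‖(2 * Real.pi * I : ℂ)⁻¹‖ * (‖∫ u, h u‖ + (∫ u : ℝ, ‖((u : ℂ) + I) * h u‖) * b⁻¹),
    fun x y hy => ?_⟩
  have hy0 : 0 < y := hb.trans_le hy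
  have hw : ((x : ℂ) + y * I).im ≠ 0 := by simpa using hy0.ne'
  have h3 : Integrable fun u : ℝ => (((u : ℂ) + I) * h u) * ((u : ℂ) - (x + y * I))⁻¹ :=
    integrable_mul_inv_sub le_rfl (by simp) (memLp_one_iff_integrable.2 h2) hw
  have e : ((x : ℂ) + y * I + I) * ∫ u : ℝ, h u * ((u : ℂ) - (x + y * I))⁻¹ =
      -(∫ u, h u) + ∫ u : ℝ, (((u : ℂ) + I) * h u) * ((u : ℂ) - (x + y * I))⁻¹ := by
    rw [← integral_const_mul, neg_add_eq_sub, ← integral_sub h3 h1]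
    refine integral_congr_ae (ae_of_all _ fun u => ?_)
    have := ofReal_sub_ne_zero hw u
    simp only
    field_simp
    ring
  have hge : ‖(x : ℂ) + I‖ ≤ ‖(x : ℂ) + y * I + I‖ := by
    rw [Complex.norm_eq_sqrt_sq_add_sq, Complex.norm_eq_sqrt_sq_add_sq]
    apply Real.sqrt_le_sqrt
    simp only [add_re, ofReal_re, I_re, add_zero, add_im, ofReal_im, I_im, zero_add, mul_re,
      mul_zero, mul_one, sub_zero, mul_im]
    nlinarith
  have hpos : 0 < ‖(x : ℂ) + I‖ := norm_pos_iff.2 (ofReal_add_I_ne_zero x)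
  have h4 : ‖∫ u : ℝ, (((u : ℂ) + I) * h u) * ((u : ℂ) - (x + y * I))⁻¹‖ ≤
      (∫ u : ℝ, ‖((u : ℂ) + I) * h u‖) * b⁻¹ := by
    rw [← integral_mul_const]
    refine norm_integral_le_of_norm_le (h2.norm.mul_const _) (ae_of_all _ fun u => ?_)
    rw [norm_mul _ (_)⁻¹, norm_inv]
    gcongr
    have := Complex.abs_im_le_norm ((u : ℂ) - (x + y * I))
    simp only [sub_im, ofReal_im, add_im, mul_im, ofReal_re, I_im, mul_one, I_re, mul_zero,
      add_zero, zero_add, zero_sub, abs_neg, abs_of_pos hy0] at this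
    exact hy.trans this
  have h5 : ‖∫ u : ℝ, h u * ((u : ℂ) - (x + y * I))⁻¹‖ ≤
      (‖∫ u, h u‖ + (∫ u : ℝ, ‖((u : ℂ) + I) * h u‖) * b⁻¹) * ‖((x : ℂ) + I)⁻¹‖ := by
    rw [norm_inv, ← div_eq_mul_inv, le_div_iff₀ hpos]
    calc _ ≤ ‖∫ u : ℝ, h u * ((u : ℂ) - (x + y * I))⁻¹‖ * ‖(x : ℂ) + y * I + I‖ := by gcongr
      _ = ‖-(∫ u, h u) + ∫ u : ℝ, (((u : ℂ) + I) * h u) * ((u : ℂ) - (x + y * I))⁻¹‖ := by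
          rw [← e, norm_mul, mul_comm]
      _ ≤ _ := (norm_add_le _ _).trans (by rw [norm_neg]; gcongr)
  rw [lineCauchy, norm_mul, mul_assoc ‖(2 * Real.pi * I : ℂ)⁻¹‖]
  exact mul_le_mul_of_nonneg_left h5 (norm_nonneg _)

lemma lineCauchy_conj {h : ℝ → ℂ} (hr : ∀ x, conj (h x) = h x) (z : ℂ) :
    lineCauchy h (conj z) = -conj (lineCauchy h z) := by
  simp only [lineCauchy, map_mul, map_inv₀, ← integral_conj, hr, map_sub, conj_ofReal, conj_I,
    map_ofNat]
  simp

/-- A real function in `L_{2m}` with enough decay is the sum of a function in `H_{2m}^+` and its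
conjugate. With `U` the Cauchy integral, `∫ U(x + iy)^{2m} dx = 0` bounds the `L_{2m}` norm of `U`
by that of its real part, the Poisson integral; the same bound for differences of translates of `U`
yields the boundary values. -/
lemma exists_memHardyPlus_of_real {h : ℝ → ℂ} (hm : StronglyMeasurable h)
    (hr : ∀ x, conj (h x) = h x) (h1 : Integrable h)
    (h2 : Integrable fun u : ℝ => ((u : ℂ) + I) * h u) (m : ℕ)
    (hL : MemLp h (2 * (m + 1) : ℕ) volume) :
    ∃ u : ℝ → ℂ, MemHardyPlus (2 * (m + 1) : ℕ) u ∧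
      MemHardyMinus (2 * (m + 1) : ℕ) (fun x => h x - u x) := by
  obtain ⟨K, hK⟩ := eLpNorm_le_eLpNorm_re m
  have hdiff : ∀ z : ℂ, 0 < z.im → DifferentiableAt ℂ (lineCauchy h) z := fun z hz =>
    differentiableAt_lineCauchy le_rfl (by simp) (memLp_one_iff_integrable.2 h1) hz.ne'
  have hre : ∀ y : ℝ, 0 < y → ∀ x : ℝ, ((lineCauchy h (x + y * I)).re : ℂ) =
      (1 / 2) * poissonInt h y x := by
    intro y hy x
    rw [← lineCauchy_sub le_rfl (by simp) (memLp_one_iff_integrable.2 h1) hy x]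
    have e : (x : ℂ) - y * I = conj ((x : ℂ) + y * I) := by simp [sub_eq_add_neg]
    rw [e, lineCauchy_conj hr, sub_neg_eq_add, Complex.add_conj]
    push_cast
    ring
  set n : ℝ≥0∞ := ((2 * (m + 1) : ℕ) : ℝ≥0∞) with hn
  have hn1 : 1 < n := by
    rw [hn]; exact_mod_cast (show 1 < 2 * (m + 1) by omega)
  have hnt : n ≠ ∞ := ENNReal.natCast_ne_top _
  have mU : ∀ y : ℝ, 0 < y →
      AEStronglyMeasurable (fun x : ℝ => lineCauchy h (x + y * I)) volume := fun y hy =>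
    aesm_of_diffOn (s := {z : ℂ | 0 < z.im}) (fun z hz => (hdiff z hz).differentiableWithinAt) _
      (by fun_prop) (by simpa using hy)
  have memU : ∀ y : ℝ, 0 < y → MemLp (fun x : ℝ => lineCauchy h (x + y * I)) n volume := by
    intro y hy
    obtain ⟨D, hD⟩ := norm_lineCauchy_le h1 h2 hy
    exact memLp_of_norm_le_inv_add_I (mU y hy) (fun x => hD x y le_rfl) hn1
  -- the basic estimate, for `c = 0` and for differences, `c = 1`
  have key : ∀ (c : ℝ) (y y' : ℝ), 0 < y → 0 < y' →
      eLpNorm (fun x : ℝ => lineCauchy h (x + y * I) - c * lineCauchy h (x + y' * I)) n volume ≤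
        K * eLpNorm (fun x : ℝ => poissonInt h y x - c * poissonInt h y' x) n volume := by
    intro c y y' hy hy'
    -- the decay of the Cauchy integral is uniform only away from the real line
    set a := min y y' / 2 with ha
    have ha0 : 0 < a := by have := lt_min hy hy'; positivity
    have hay : a < y := by
      have := min_le_left y y'; linarith [lt_min hy hy']
    have hay' : a < y' := by
      have := min_le_right y y'; linarith [lt_min hy hy']
    have him : ∀ (b : ℝ) (z : ℂ), (z + (b : ℂ) * I).im = z.im + b := fun b z => by simp
    obtain ⟨D, hD⟩ := norm_lineCauchy_le h1 h2 (lt_min (sub_pos.2 hay) (sub_pos.2 hay'))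
    set V : ℂ → ℂ := fun z => lineCauchy h (z + ((y - a : ℝ) : ℂ) * I) -
      c * lineCauchy h (z + ((y' - a : ℝ) : ℂ) * I) with hV
    have hVd : DifferentiableOn ℂ V {z : ℂ | 0 < z.im} := by
      intro z hz
      have hz' : 0 < z.im := hz
      have d1 := DifferentiableAt.comp (f := fun z : ℂ => z + ((y - a : ℝ) : ℂ) * I) z
        (hdiff _ (by rw [him]; linarith)) (by fun_prop)
      have d2 := DifferentiableAt.comp (f := fun z : ℂ => z + ((y' - a : ℝ) : ℂ) * I) z
        (hdiff _ (by rw [him]; linarith)) (by fun_prop)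
      exact (d1.sub (d2.const_mul (c : ℂ))).differentiableWithinAt
    have hVb : ∀ x s : ℝ, 0 < s → ‖V (x + s * I)‖ ≤ (D + |c| * D) * ‖((x : ℂ) + I)⁻¹‖ := by
      intro x s hs
      have e : ∀ b : ℝ, (x : ℂ) + s * I + (b : ℂ) * I = x + ((s + b : ℝ) : ℂ) * I := fun b => by
        push_cast; ring
      simp only [hV, e]
      refine (norm_sub_le _ _).trans ?_
      rw [norm_mul, norm_real, Real.norm_eq_abs, add_mul, mul_assoc]
      gcongr
      · exact hD _ _ ((min_le_left _ _).trans (by linarith))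
      · exact hD _ _ ((min_le_right _ _).trans (by linarith))
    have hVa : ∀ x : ℝ, V (x + a * I) =
        lineCauchy h (x + y * I) - c * lineCauchy h (x + y' * I) := fun x => by
      simp only [hV]
      have e : ∀ b : ℝ, (x : ℂ) + a * I + ((b - a : ℝ) : ℂ) * I = x + b * I := fun b => by
        push_cast; ring
      rw [e, e]
    have h0 := integral_pow_eq_zero_of_norm_le hVd hVb m ha0
    simp only [hVa] at h0
    have hmem : MemLp (fun x : ℝ => lineCauchy h (x + y * I) - c * lineCauchy h (x + y' * I))
        n volume := (memU y hy).sub ((memU y' hy').const_mul (c : ℂ))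
    refine (hK _ hmem h0).trans ?_
    gcongr
    refine eLpNorm_mono fun x => ?_
    rw [← norm_real]
    have e : (((lineCauchy h (x + y * I) - c * lineCauchy h (x + y' * I)).re : ℝ) : ℂ) =
        (1 / 2) * (poissonInt h y x - c * poissonInt h y' x) := by
      rw [sub_re, re_ofReal_mul]
      push_cast
      rw [hre y hy, hre y' hy']
      ring
    rw [e, norm_mul]
    refine mul_le_of_le_one_left (norm_nonneg _) (by norm_num)
  have hpois := tendsto_poissonInt_sub hm hn1.le hnt hL
    fun y hy x => integrable_cauchyMeasure hn1.le hnt hL hy x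
  have mP : ∀ y : ℝ, 0 < y → AEStronglyMeasurable (poissonInt h y) volume := fun y hy => by
    have : poissonInt h y = fun x : ℝ => 2 * ((lineCauchy h (x + y * I)).re : ℂ) := by
      ext x
      rw [hre y hy]
      ring
    rw [this]
    exact (continuous_ofReal.comp_aestronglyMeasurable
      (continuous_re.comp_aestronglyMeasurable (mU y hy))).const_mul 2
  -- convergence of the horizontal translates in `L_{2m}`
  obtain ⟨u, hu, hut⟩ : ∃ u : ℝ → ℂ, MemLp u n volume ∧ Tendsto (fun y : ℝ =>
      eLpNorm (fun x : ℝ => lineCauchy h (x + y * I) - u x) n volume) (𝓝[>] 0) (𝓝 0) := by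
    have : Fact (1 ≤ n) := ⟨hn1.le⟩
    classical
    let T : ℝ → Lp ℂ n (volume : Measure ℝ) := fun y =>
      if hy : 0 < y then (memU y hy).toLp _ else 0
    have hT : Cauchy (map T (𝓝[>] 0)) := by
      rw [EMetric.cauchy_iff]
      refine ⟨NeBot.ne inferInstance, fun ε hε => ?_⟩
      have hlim : Tendsto (fun y : ℝ => K * eLpNorm (fun x => poissonInt h y x - h x) n volume)
          (𝓝[>] 0) (𝓝 0) := by
        simpa using ENNReal.Tendsto.const_mul hpois (Or.inr (ENNReal.coe_ne_top (r := K)))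
      have hev := (hlim.eventually (gt_mem_nhds (ENNReal.half_pos hε.ne'))).and
        (self_mem_nhdsWithin : Set.Ioi (0 : ℝ) ∈ 𝓝[>] 0)
      refine ⟨T '' {y | _}, image_mem_map hev, ?_⟩
      rintro _ ⟨y, ⟨hy1, hy⟩, rfl⟩ _ ⟨y', ⟨hy1', hy'⟩, rfl⟩
      have hy0 : 0 < y := hy
      have hy0' : 0 < y' := hy'
      simp only [T, dif_pos hy0, dif_pos hy0', Lp.edist_toLp_toLp]
      have h3 := key 1 y y' hy0 hy0'
      simp only [ofReal_one, one_mul] at h3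
      refine (h3.trans ?_).trans_lt ((ENNReal.add_lt_add hy1 hy1').trans_eq (ENNReal.add_halves ε))
      rw [← mul_add]
      gcongr
      have e : (fun x => poissonInt h y x - poissonInt h y' x) =
          (fun x => poissonInt h y x - h x) - (fun x => poissonInt h y' x - h x) := by
        ext x
        simp
      rw [e]
      exact eLpNorm_sub_le ((mP y hy0).sub hL.1) ((mP y' hy0').sub hL.1) hn1.le
    obtain ⟨u, hu⟩ := CompleteSpace.complete hT
    refine ⟨u, Lp.memLp u, ?_⟩
    have h3 := (Lp.tendsto_Lp_iff_tendsto_eLpNorm' T u).1 hu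
    refine h3.congr' ?_
    filter_upwards [self_mem_nhdsWithin] with y hy
    have hy0 : 0 < y := hy
    refine eLpNorm_congr_ae ?_
    simp only [T, dif_pos hy0]
    filter_upwards [(memU y hy0).coeFn_toLp] with x hx
    rw [Pi.sub_apply, hx]
  have hup : MemHardyPlus n u := by
    refine ⟨hu, lineCauchy h, fun z hz => (hdiff z hz).differentiableWithinAt,
      ⟨K * (eLpNorm h n volume).toNNReal, fun y hy => ?_⟩, hut⟩
    have h3 := key 0 y y hy hy
    simp only [ofReal_zero, zero_mul, sub_zero] at h3
    push_cast
    rw [ENNReal.coe_toNNReal hL.2.ne]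
    exact h3.trans (mul_le_mul_right (eLpNorm_poissonInt_le hm hn1.le hnt y) _)
  refine ⟨u, hup, hup.conj_minus.congr ?_⟩
  have hsum : Tendsto (fun y : ℝ => eLpNorm (fun x => conj (u x) - (h x - u x)) n volume)
      (𝓝[>] 0) (𝓝 0) := by
    have t1 : Tendsto (fun y : ℝ => eLpNorm (fun x => conj (u x) -
        conj (lineCauchy h (x + y * I))) n volume) (𝓝[>] 0) (𝓝 0) :=
      hut.congr fun y => eLpNorm_congr_norm_ae (ae_of_all _ fun x => by
        simp only [← map_sub, RCLike.norm_conj]; exact norm_sub_rev _ _)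
    have t2 : Tendsto (fun y : ℝ => eLpNorm (fun x => u x - lineCauchy h (x + y * I)) n volume)
        (𝓝[>] 0) (𝓝 0) :=
      hut.congr fun y => eLpNorm_congr_norm_ae (ae_of_all _ fun x => norm_sub_rev _ _)
    refine (tendsto_eLpNorm_add (fun y hy => (hu.1.star.sub (mU y hy).star).add
      (hu.1.sub (mU y hy))) (fun y hy => (mP y hy).sub hL.1)
      (tendsto_eLpNorm_add (fun y hy => hu.1.star.sub (mU y hy).star)
        (fun y hy => hu.1.sub (mU y hy)) t1 t2) hpois).congr' ?_
    filter_upwards [self_mem_nhdsWithin] with y hy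
    congr 1
    ext x
    have h3 := hre y hy x
    have h4 := Complex.add_conj (lineCauchy h (x + y * I))
    push_cast at h4
    simp only [Pi.add_apply, Pi.sub_apply, RCLike.star_def, Pi.star_apply]
    linear_combination -h4 - 2 * h3
  have h5 := tendsto_nhds_unique tendsto_const_nhds hsum
  have h6 := (eLpNorm_eq_zero_iff (hu.1.star.sub (hL.1.sub hu.1))
    (zero_lt_one.trans hn1).ne').1 h5
  filter_upwards [h6] with x hx
  exact sub_eq_zero.1 hx

lemma exists_memHardyPlus_even {h : ℝ → ℂ} (h1 : Integrable h)
    (h2 : Integrable fun u : ℝ => ((u : ℂ) + I) * h u) (m : ℕ)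
    (hL : MemLp h (2 * (m + 1) : ℕ) volume) :
    ∃ u : ℝ → ℂ, MemHardyPlus (2 * (m + 1) : ℕ) u ∧
      MemHardyMinus (2 * (m + 1) : ℕ) (fun x => h x - u x) := by
  wlog hm : StronglyMeasurable h generalizing h
  · have hmk := h1.1.ae_eq_mk
    obtain ⟨u, hu, hv⟩ := this (h1.congr hmk) (h2.congr (by filter_upwards [hmk] with x hx; rw [hx]))
      (hL.ae_eq hmk) h1.1.stronglyMeasurable_mk
    exact ⟨u, hu, hv.congr (by filter_upwards [hmk] with x hx; rw [hx])⟩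
  have hmul : ∀ {φ : ℝ → ℝ}, StronglyMeasurable φ → (∀ x, |φ x| ≤ ‖h x‖) →
      ∃ u : ℝ → ℂ, MemHardyPlus (2 * (m + 1) : ℕ) u ∧
        MemHardyMinus (2 * (m + 1) : ℕ) (fun x => (φ x : ℂ) - u x) := by
    intro φ hφ hle
    have hφm : StronglyMeasurable fun x => (φ x : ℂ) := continuous_ofReal.comp_stronglyMeasurable hφ
    refine exists_memHardyPlus_of_real hφm (fun x => conj_ofReal _)
      (h1.mono hφm.aestronglyMeasurable (ae_of_all _ fun x => ?_))
      (h2.mono ((Continuous.aestronglyMeasurable (by fun_prop)).mul hφm.aestronglyMeasurable)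
        (ae_of_all _ fun x => ?_)) m
      (hL.mono hφm.aestronglyMeasurable (ae_of_all _ fun x => ?_))
    · rw [norm_real]; exact hle x
    · rw [norm_mul, norm_mul, norm_real]
      exact mul_le_mul_of_nonneg_left (hle x) (norm_nonneg _)
    · rw [norm_real]; exact hle x
  obtain ⟨u, hu, hv⟩ := hmul (continuous_re.comp_stronglyMeasurable hm)
    fun x => Complex.abs_re_le_norm _
  obtain ⟨u', hu', hv'⟩ := hmul (continuous_im.comp_stronglyMeasurable hm)
    fun x => Complex.abs_im_le_norm _
  refine ⟨fun x => u x + I * u' x, hu.add (hu'.const_mul I), ?_⟩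
  refine (hv.add (hv'.const_mul I)).congr (ae_of_all _ fun x => ?_)
  have := Complex.re_add_im (h x)
  linear_combination this

lemma holderTriple_of_lt {n p : ℝ≥0∞} (hp : 1 < p) (hpn : p < n) :
    ∃ s : ℝ≥0∞, 1 < s ∧ ENNReal.HolderTriple n s p := by
  refine ⟨(p⁻¹ - n⁻¹)⁻¹, ?_, ⟨?_⟩⟩
  · rw [ENNReal.one_lt_inv]
    exact tsub_le_self.trans_lt (ENNReal.inv_lt_one.2 hp)
  · rw [inv_inv, add_tsub_cancel_of_le (ENNReal.inv_le_inv.2 hpn.le)]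

/-- The Riesz decomposition `h = u + v`, `u ∈ H_p^+`, `v ∈ H_p^-`, of a rapidly decaying function.
It is obtained from that of `(x + i) h` in `L_{2m}`, `2m > p`, by dividing by `x + i`; the pole
of the second summand at `-i` is moved to the first one. -/
lemma exists_memHardyPlus_sub_memHardyMinus {h : ℝ → ℂ} {p : ℝ≥0∞} (hp : 1 < p) (hp' : p ≠ ∞)
    (h1 : Integrable fun u : ℝ => ((u : ℂ) + I) * h u)
    (h2 : Integrable fun u : ℝ => ((u : ℂ) + I) * (((u : ℂ) + I) * h u))
    (hL : ∀ s : ℝ≥0∞, 1 < s → MemLp (fun u : ℝ => ((u : ℂ) + I) * h u) s volume) :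
    ∃ u : ℝ → ℂ, MemHardyPlus p u ∧ MemHardyMinus p (fun x => h x - u x) := by
  obtain ⟨m, hm⟩ := ENNReal.exists_nat_gt hp'
  have hpn : p < ((2 * (m + 1) : ℕ) : ℝ≥0∞) :=
    hm.trans_le (by exact_mod_cast (show m ≤ 2 * (m + 1) by omega))
  obtain ⟨U, hU, hV⟩ := exists_memHardyPlus_even h1 h2 m (hL _ (hp.trans hpn))
  set n : ℝ≥0∞ := ((2 * (m + 1) : ℕ) : ℝ≥0∞) with hn
  have hnt : n ≠ ∞ := ENNReal.natCast_ne_top _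
  have hn1 : 1 < n := hp.trans hpn
  obtain ⟨s, hs, _⟩ := holderTriple_of_lt hp hpn
  obtain ⟨c, hc⟩ := hV.conj_plus.exists_sub_mul_rFun_inv hn1.le (memHardyPlus_inv_add_I hn1)
    (not_memHardyPlus_inv_add_I_mul hn1 hnt)
  have hc' := (hc.mul (memHardyPlus_inv_add_I hs) (t := p)).conj_minus
  refine ⟨fun x => U x * ((x : ℂ) + I)⁻¹ - (conj c / (2 * I)) * ((x : ℂ) + I)⁻¹,
    (hU.mul (memHardyPlus_inv_add_I hs)).sub ((memHardyPlus_inv_add_I hp).const_mul _), ?_⟩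
  refine (hc'.add ((memHardyMinus_inv_sub_I hp).const_mul (conj c / (2 * I)))).congr
    (ae_of_all _ fun x => ?_)
  have n1 := ofReal_add_I_ne_zero x
  have n2 := ofReal_sub_I_ne_zero x
  have hI := I_ne_zero
  simp only [map_mul, map_sub, map_inv₀, conj_rFun, inv_inv, conj_conj, conj_ofReal, conj_I,
    map_add, ← sub_eq_add_neg]
  have e1 : rFun x * ((x : ℂ) - I)⁻¹ = ((x : ℂ) + I)⁻¹ := (inv_add_I_eq x).symm
  have e2 : ((x : ℂ) - I)⁻¹ - ((x : ℂ) + I)⁻¹ = 2 * I * (((x : ℂ) - I)⁻¹ * ((x : ℂ) + I)⁻¹) := by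
    field_simp
    ring
  have e3 : ((x : ℂ) + I) * ((x : ℂ) + I)⁻¹ = 1 := mul_inv_cancel₀ n1
  have e4 : conj c / (2 * I) * (2 * I) = conj c := by field_simp
  linear_combination (((x : ℂ) + I) * h x - U x - conj c * ((x : ℂ) - I)⁻¹) * e1 +
    conj c / (2 * I) * e2 + ((x : ℂ) - I)⁻¹ * ((x : ℂ) + I)⁻¹ * e4 + h x * e3

/-! ### The kernel of the adjoint -/

lemma mem_toeplitzKer_iff {p : ℝ≥0∞} {g : ℝ → ℂ} {ψ : Lp ℂ p (volume : Measure ℝ)} :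
    ψ ∈ toeplitzKer p g ↔ MemHardyPlus p ψ ∧ MemHardyMinus p (fun x => g x * ψ x) := by
  have h : ((0 : Lp ℂ p (volume : Measure ℝ)) : ℝ → ℂ) =ᵐ[volume] fun _ => 0 :=
    Lp.coeFn_zero ℂ p volume
  constructor
  · rintro ⟨h1, -, h3⟩
    refine ⟨h1, h3.congr ?_⟩
    filter_upwards [h] with x hx
    change g x * ψ x - (0 : Lp ℂ p (volume : Measure ℝ)) x = _
    rw [hx, sub_zero]
  · rintro ⟨h1, h3⟩
    refine ⟨h1, (MemHardyPlus.zero p).congr h.symm, h3.congr ?_⟩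
    filter_upwards [h] with x hx
    change _ = g x * ψ x - (0 : Lp ℂ p (volume : Measure ℝ)) x
    rw [hx, sub_zero]

lemma mem_toeplitzAdjointKer_iff {p p' : ℝ≥0∞} [ENNReal.HolderConjugate p p'] {g : ℝ → ℂ}
    {ψ : Lp ℂ p' (volume : Measure ℝ)} :
    ψ ∈ toeplitzAdjointKer p p' g ↔ MemHardyPlus p' ψ ∧
      ∀ f u : Lp ℂ p (volume : Measure ℝ), (f, u) ∈ toeplitzGraph p g →
        ∫ x, u x * conj (ψ x) = 0 := by
  have h : ((0 : Lp ℂ p' (volume : Measure ℝ)) : ℝ → ℂ) =ᵐ[volume] fun _ => 0 :=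
    Lp.coeFn_zero ℂ p' volume
  have key : ∀ a : Lp ℂ p (volume : Measure ℝ),
      ∫ x, a x * conj ((0 : Lp ℂ p' (volume : Measure ℝ)) x) = 0 := fun a => by
    refine integral_eq_zero_of_ae ?_
    filter_upwards [h] with x hx
    simp
  constructor
  · rintro ⟨h1, -, h3⟩
    exact ⟨h1, fun f u hfu => (h3 f u hfu).trans (key f)⟩
  · rintro ⟨h1, h3⟩
    exact ⟨h1, (MemHardyPlus.zero p').congr h.symm, fun f u hfu => (h3 f u hfu).trans (key f).symm⟩

/-- The function `i (N + 1) / (x + i (N + 1))` of `H_s^+`, `s > 1`: it is bounded by one and tends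
to one. -/
noncomputable def approxOne (N : ℕ) (x : ℝ) : ℂ := (I * (N + 1)) * ((x : ℂ) + I * (N + 1))⁻¹

lemma add_I_mul_ne_zero (N : ℕ) (x : ℝ) : (x : ℂ) + I * (N + 1) ≠ 0 := fun h => by
  have := congrArg im h
  simp at this
  norm_cast at this

lemma memHardyPlus_approxOne (N : ℕ) {s : ℝ≥0∞} (hs : 1 < s) : MemHardyPlus s (approxOne N) := by
  have hw : (-(I * ((N : ℂ) + 1))).im < 0 := by
    have h : (-(I * ((N : ℂ) + 1))).im = -(N + 1) := by simp
    rw [h, neg_lt_zero]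
    positivity
  have := (memHardyPlus_inv_sub hw hs).const_mul (I * (N + 1))
  simp only [sub_neg_eq_add] at this
  exact this

lemma norm_approxOne_le (N : ℕ) (x : ℝ) : ‖approxOne N x‖ ≤ 1 := by
  rw [approxOne, norm_mul, norm_inv, ← div_eq_mul_inv,
    div_le_one (norm_pos_iff.2 (add_I_mul_ne_zero N x))]
  have h1 := Complex.abs_im_le_norm ((x : ℂ) + I * (N + 1))
  have h2 : ‖I * ((N : ℂ) + 1)‖ = N + 1 := by
    rw [norm_mul, norm_I, one_mul]
    exact_mod_cast Complex.norm_natCast (N + 1)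
  have h3 : ((x : ℂ) + I * (N + 1)).im = N + 1 := by simp
  rw [h3, abs_of_nonneg (by positivity)] at h1
  rwa [h2]

lemma tendsto_approxOne (x : ℝ) : Tendsto (fun N : ℕ => approxOne N x) atTop (𝓝 1) := by
  have h1 : ∀ N : ℕ, approxOne N x = (1 - I * x * (((N : ℝ) + 1)⁻¹ : ℝ))⁻¹ := fun N => by
    have h2 := add_I_mul_ne_zero N x
    have h3 : (N : ℂ) + 1 ≠ 0 := by exact_mod_cast Nat.succ_ne_zero N
    have e : (1 - I * x * (((N : ℝ) + 1)⁻¹ : ℝ)) =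
        (-I * ((N : ℂ) + 1)⁻¹) * ((x : ℂ) + I * (N + 1)) := by
      push_cast
      field_simp
      linear_combination ((N : ℂ) + 1) * I_sq
    have hI := I_ne_zero
    rw [e, mul_inv, approxOne]
    congr 1
    field_simp
    linear_combination I_sq
  simp only [h1]
  have h4 : Tendsto (fun N : ℕ => ((N : ℝ) + 1)⁻¹) atTop (𝓝 0) := by
    simpa using tendsto_one_div_add_atTop_nhds_zero_nat (𝕜 := ℝ)
  have h5 : ContinuousAt (fun s : ℝ => (1 - I * x * (s : ℂ))⁻¹) 0 := by
    refine ContinuousAt.inv₀ (by fun_prop) (by simp)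
  have h6 := h5.tendsto.comp h4
  simpa [Function.comp_def] using h6

lemma memLp_add_I_mul_approxOne (N : ℕ) :
    MemLp (fun x : ℝ => ((x : ℂ) + I) * approxOne N x) ∞ volume := by
  have h := ((memLp_top_const (μ := (volume : Measure ℝ)) (I * ((N : ℂ) + 1))).add
    ((memHardyPlus_approxOne N (s := ∞) (by simp)).1.const_mul (I - I * (N + 1))))
  refine h.ae_eq (ae_of_all _ fun x => ?_)
  have h2 := mul_inv_cancel₀ (add_I_mul_ne_zero N x)
  simp only [Pi.add_apply, approxOne]
  linear_combination (-(I * ((N : ℂ) + 1))) * h2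

theorem toeplitzAdjointKer_eq {p p' : ℝ≥0∞} [ENNReal.HolderConjugate p p'] (hp : 1 < p)
    (hp' : p ≠ ∞) {g : ℝ → ℂ} (hg : MemLp g ∞ (volume : Measure ℝ)) :
    toeplitzAdjointKer p p' g = toeplitzKer p' (fun x => conj (g x)) := by
  have hq : 1 < p' := (ENNReal.HolderConjugate.lt_top_iff_one_lt p p').1 hp'.lt_top
  have hq' : p' ≠ ∞ := ((ENNReal.HolderConjugate.lt_top_iff_one_lt p' p).2 hp).ne
  ext ψ
  rw [mem_toeplitzKer_iff, mem_toeplitzAdjointKer_iff]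
  refine and_congr_right fun hψ => ⟨fun h => ?_, fun h f u hfu => ?_⟩
  · have hb : MemLp (fun x => g x * conj (ψ x)) p' volume := hψ.1.star.mul' hg
    suffices MemHardyPlus p' fun x => g x * conj (ψ x) by
      simpa using this.conj_minus
    refine memHardyPlus_of_integral_eq_zero hq.le hq' hb fun w hw => ?_
    -- the test function `f = approxOne N ^ 3 / (x - w)` decays fast enough for `g f` to decompose
    have hN : ∀ N : ℕ, ∫ x : ℝ, g x * conj (ψ x) * (((x : ℂ) - w)⁻¹ * approxOne N x ^ 3) = 0 := by
      intro N
      have e0 := memHardyPlus_approxOne N (s := ∞) (by simp)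
      have hf : MemHardyPlus p fun x : ℝ => ((x : ℂ) - w)⁻¹ * approxOne N x ^ 3 := by
        have := (memHardyPlus_inv_sub hw hp).mul
          ((e0.mul e0 (t := ∞)).mul e0 (t := ∞)) (t := p)
        refine this.congr (ae_of_all _ fun x => ?_)
        ring
      have hB := memLp_add_I_mul_approxOne N
      have e2 := (memHardyPlus_approxOne N (s := 2) (by norm_num)).1
      have r2 := (memHardyPlus_inv_sub hw (s := 2) (by norm_num)).1
      have i1 : MemLp (fun x : ℝ => ((x : ℂ) - w)⁻¹ * approxOne N x) 1 volume := e2.mul' r2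
      have c1 : MemLp (fun x : ℝ => ((x : ℂ) + I) *
          (g x * (((x : ℂ) - w)⁻¹ * approxOne N x ^ 3))) 1 volume := by
        have h1 : MemLp (fun x => g x * (((x : ℂ) + I) * approxOne N x)) ∞ volume := hB.mul' hg
        have h2 : MemLp (fun x => g x * (((x : ℂ) + I) * approxOne N x) * approxOne N x) ∞
          volume := e0.1.mul' h1
        have h3 : MemLp (fun x => g x * (((x : ℂ) + I) * approxOne N x) * approxOne N x *
          (((x : ℂ) - w)⁻¹ * approxOne N x)) 1 volume := i1.mul' h2
        exact h3.ae_eq (ae_of_all _ fun x => by ring)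
      have c2 : MemLp (fun x : ℝ => ((x : ℂ) + I) * (((x : ℂ) + I) *
          (g x * (((x : ℂ) - w)⁻¹ * approxOne N x ^ 3)))) 1 volume := by
        have h1 : MemLp (fun x => g x * (((x : ℂ) + I) * approxOne N x)) ∞ volume := hB.mul' hg
        have h2 : MemLp (fun x => g x * (((x : ℂ) + I) * approxOne N x) *
          (((x : ℂ) + I) * approxOne N x)) ∞ volume := hB.mul' h1
        have h3 : MemLp (fun x => g x * (((x : ℂ) + I) * approxOne N x) *
          (((x : ℂ) + I) * approxOne N x) *
          (((x : ℂ) - w)⁻¹ * approxOne N x)) 1 volume := i1.mul' h2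
        exact h3.ae_eq (ae_of_all _ fun x => by ring)
      have c3 : ∀ s : ℝ≥0∞, 1 < s → MemLp (fun x : ℝ => ((x : ℂ) + I) *
          (g x * (((x : ℂ) - w)⁻¹ * approxOne N x ^ 3))) s volume := by
        intro s hs
        have h1 : MemLp (fun x => g x * (((x : ℂ) + I) * approxOne N x)) ∞ volume := hB.mul' hg
        have h2 : MemLp (fun x => g x * (((x : ℂ) + I) * approxOne N x) * approxOne N x) ∞
          volume := e0.1.mul' h1
        have h3 : MemLp (fun x => g x * (((x : ℂ) + I) * approxOne N x) * approxOne N x *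
          approxOne N x) ∞ volume := e0.1.mul' h2
        have h4 : MemLp (fun x => g x * (((x : ℂ) + I) * approxOne N x) * approxOne N x *
          approxOne N x * ((x : ℂ) - w)⁻¹) s volume := (memHardyPlus_inv_sub hw hs).1.mul' h3
        exact h4.ae_eq (ae_of_all _ fun x => by ring)
      obtain ⟨u, hu, hv⟩ := exists_memHardyPlus_sub_memHardyMinus hp hp'
        (memLp_one_iff_integrable.1 c1) (memLp_one_iff_integrable.1 c2) c3
      have tf := hf.1.coeFn_toLp
      have tu := hu.1.coeFn_toLp
      have h0 := h (hf.1.toLp _) (hu.1.toLp u) ⟨hf.congr tf.symm, hu.congr tu.symm, hv.congr (by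
        filter_upwards [tf, tu] with x hx hx'
        rw [hx, hx'])⟩
      have h1 : ∫ x, u x * conj (ψ x) = 0 := by
        rw [← h0]
        refine integral_congr_ae ?_
        filter_upwards [tu] with x hx
        rw [hx]
      have m1 := hv.mul hψ.conj_minus (t := 1)
      have h2 := m1.integral_eq_zero
      have m2 : Integrable fun x => u x * conj (ψ x) := hu.1.integrable_mul (q := p') hψ.1.star
      have h3 := integral_add m2 (memLp_one_iff_integrable.1 m1.1)
      rw [h1, h2, add_zero] at h3
      rw [← h3]
      refine integral_congr_ae (ae_of_all _ fun x => ?_)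
      ring
    have hint := integrable_mul_inv_sub hq.le hq' hb hw.ne
    have hlim : Tendsto (fun N : ℕ => ∫ x : ℝ, g x * conj (ψ x) *
        (((x : ℂ) - w)⁻¹ * approxOne N x ^ 3)) atTop
        (𝓝 (∫ x : ℝ, g x * conj (ψ x) * ((x : ℂ) - w)⁻¹)) := by
      refine tendsto_integral_of_dominated_convergence
        (fun x : ℝ => ‖g x * conj (ψ x) * ((x : ℂ) - w)⁻¹‖) (fun N => ?_) hint.norm
        (fun N => ae_of_all _ fun x => ?_) (ae_of_all _ fun x => ?_)
      · have := hint.1.mul ((memHardyPlus_approxOne N (s := ∞) (by simp)).1.1.pow 3)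
        refine this.congr (ae_of_all _ fun x => ?_)
        simp only [Pi.mul_apply, Pi.pow_apply]
        ring
      · rw [← mul_assoc, norm_mul, norm_pow]
        exact mul_le_of_le_one_right (norm_nonneg _)
          (pow_le_one₀ (norm_nonneg _) (norm_approxOne_le N x))
      · have := (((tendsto_approxOne x).pow 3).const_mul
          (g x * conj (ψ x) * ((x : ℂ) - w)⁻¹))
        simpa only [one_pow, mul_one, mul_assoc] using this
    refine tendsto_nhds_unique hlim ?_
    simp only [hN, tendsto_const_nhds]
  · obtain ⟨hf, hu, hv⟩ := hfu
    dsimp only at hf hu hv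
    have m1 := hf.mul h.conj_plus (t := 1)
    have m2 := hv.mul hψ.conj_minus (t := 1)
    have h3 : ∫ x, u x * conj (ψ x) = (∫ x, f x * conj (conj (g x) * ψ x)) -
        ∫ x, (g x * f x - u x) * conj (ψ x) := by
      rw [← integral_sub (memLp_one_iff_integrable.1 m1.1) (memLp_one_iff_integrable.1 m2.1)]
      refine integral_congr_ae (ae_of_all _ fun x => ?_)
      simp only [map_mul, conj_conj]
      ring
    rw [h3, m1.integral_eq_zero, m2.integral_eq_zero, sub_zero]

/-! ### Spans of powers of `r` -/

lemma rFun_injective : Function.Injective rFun := fun x y h => by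
  rw [rFun_eq, rFun_eq, sub_right_inj, mul_right_inj' (by simp), inv_inj, add_left_inj,
    ofReal_inj] at h
  exact h

lemma continuous_rFun : Continuous rFun :=
  Continuous.div (by fun_prop) (by fun_prop) ofReal_add_I_ne_zero

lemma linearIndependent_mul_rFun_pow (n : ℕ) {e : ℝ → ℂ} (he : ∀ x, e x ≠ 0) :
    LinearIndependent ℂ fun (j : Fin n) (x : ℝ) => e x * rFun x ^ (j : ℕ) := by
  rw [Fintype.linearIndependent_iff]
  intro c hc
  have h := Matrix.eq_zero_of_forall_index_sum_pow_mul_eq_zero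
    (f := fun j : Fin n => rFun ((j : ℕ) : ℝ)) (v := c)
    (fun i j hij => Fin.ext (Nat.cast_injective (rFun_injective hij))) fun j => ?_
  · exact fun i => congrFun h i
  · have h1 := congrFun hc ((j : ℕ) : ℝ)
    simp only [Finset.sum_apply, Pi.smul_apply, smul_eq_mul, Pi.zero_apply] at h1
    refine mul_left_cancel₀ (he ((j : ℕ) : ℝ)) ?_
    rw [mul_zero, ← h1, Finset.mul_sum]
    exact Finset.sum_congr rfl fun i _ => by ring

/-- The span of `1, r, …, r^n`; it is the direct sum of `K_{r^n}` and the constants. -/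
def rPowSpan (n : ℕ) : Submodule ℂ (ℝ → ℂ) :=
  Submodule.span ℂ (Set.range fun (j : Fin (n + 1)) (x : ℝ) => 1 * rFun x ^ (j : ℕ))

lemma inv_mul_rFun_pow_mem_modelSpace {n j : ℕ} (hj : j < n) :
    (fun x : ℝ => ((x : ℂ) + I)⁻¹ * rFun x ^ j) ∈ modelSpace n :=
  Submodule.subset_span ⟨⟨j, hj⟩, by ext x; simp⟩

lemma rFun_pow_sub_one_mem_modelSpace {n j : ℕ} (hj : j ≤ n) :
    (fun x => rFun x ^ j - 1) ∈ modelSpace n := by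
  have h : (fun x => rFun x ^ j - 1) = ∑ l ∈ Finset.range j,
      (-(2 * I)) • (fun x : ℝ => ((x : ℂ) + I)⁻¹ * rFun x ^ l) := by
    ext x
    simp only [Finset.sum_apply, Pi.smul_apply, smul_eq_mul]
    rw [← geom_sum_mul, Finset.sum_mul]
    refine Finset.sum_congr rfl fun l _ => ?_
    nth_rewrite 2 [rFun_eq]
    ring
  rw [h]
  exact Submodule.sum_mem _ fun l hl => Submodule.smul_mem _ _
    (inv_mul_rFun_pow_mem_modelSpace ((Finset.mem_range.1 hl).trans_le hj))

lemma exists_sub_const_mem_modelSpace {n : ℕ} {κ : ℝ → ℂ} (hκ : κ ∈ rPowSpan n) :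
    ∃ s : ℂ, (fun x => κ x - s) ∈ modelSpace n := by
  refine Submodule.span_induction (p := fun κ _ => ∃ s : ℂ, (fun x => κ x - s) ∈ modelSpace n)
    ?_ ?_ ?_ ?_ hκ
  · rintro _ ⟨j, rfl⟩
    refine ⟨1, ?_⟩
    simpa using rFun_pow_sub_one_mem_modelSpace (Nat.lt_succ_iff.1 j.2)
  · refine ⟨0, ?_⟩
    simp only [Pi.zero_apply, sub_zero]
    exact (modelSpace n).zero_mem
  · rintro x y - - ⟨s, hs⟩ ⟨t, ht⟩
    refine ⟨s + t, ?_⟩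
    convert (modelSpace n).add_mem hs ht using 1
    ext x
    simp only [Pi.add_apply]
    ring
  · rintro c x - ⟨s, hs⟩
    refine ⟨c * s, ?_⟩
    convert (modelSpace n).smul_mem c hs using 1
    ext x
    simp only [Pi.smul_apply, smul_eq_mul]
    ring

/-- `κ ↦ r^n κ̄` is a conjugation on `K_{r^n}`. -/
lemma rFun_pow_mul_conj_mem_modelSpace {n : ℕ} {κ : ℝ → ℂ} (hκ : κ ∈ modelSpace n) :
    (fun x => rFun x ^ n * conj (κ x)) ∈ modelSpace n := by
  refine Submodule.span_induction
    (p := fun κ _ => (fun x => rFun x ^ n * conj (κ x)) ∈ modelSpace n) ?_ ?_ ?_ ?_ hκ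
  · rintro _ ⟨j, rfl⟩
    convert inv_mul_rFun_pow_mem_modelSpace (n := n) (j := n - 1 - j) (by omega) using 1
    ext x
    have h0 := rFun_ne_zero x
    have h1 : n = (n - 1 - j) + 1 + j := by omega
    have h2 : conj (1 / ((x : ℂ) + I)) = ((x : ℂ) - I)⁻¹ := by
      simp [sub_eq_add_neg]
    rw [map_mul, map_pow, conj_rFun, h2, inv_add_I_eq]
    nth_rewrite 1 [h1]
    rw [pow_add, pow_succ, inv_pow]
    field_simp
  · simp only [Pi.zero_apply, map_zero, mul_zero]
    exact (modelSpace n).zero_mem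
  · rintro x y - - hx hy
    convert (modelSpace n).add_mem hx hy using 1
    ext t
    simp only [Pi.add_apply, map_add]
    ring
  · rintro c x - hx
    convert (modelSpace n).smul_mem (conj c) hx using 1
    ext t
    simp only [Pi.smul_apply, smul_eq_mul, map_mul]
    ring

lemma MemScriptHardyPlus.mul_mem {p : ℝ≥0∞} {f : ℝ → ℂ} (hf : MemScriptHardyPlus p f) {n : ℕ}
    {κ : ℝ → ℂ} (hκ : κ ∈ modelSpace n) : MemHardyPlus p (fun x => f x * κ x) := by
  refine Submodule.span_induction
    (p := fun κ _ => MemHardyPlus p (fun x => f x * κ x)) ?_ ?_ ?_ ?_ hκ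
  · rintro _ ⟨j, rfl⟩
    refine (MemHardyPlus.mul hf (memHardyPlus_rFun_pow j) (t := p)).congr (ae_of_all _ fun x => ?_)
    ring
  · simpa using! MemHardyPlus.zero p
  · rintro x y - - hx hy
    simpa [mul_add] using hx.add hy
  · rintro c x - hx
    simpa [mul_left_comm] using hx.const_mul c

lemma MemScriptHardyMinus.conj_plus {p : ℝ≥0∞} {f : ℝ → ℂ} (hf : MemScriptHardyMinus p f) :
    MemScriptHardyPlus p (fun x => conj (f x)) := by
  have := MemHardyMinus.conj_plus hf
  simpa [MemScriptHardyPlus] using this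

/-! ### The dimension of a space of multiples -/

lemma rank_eq_of_multiples {s : ℝ≥0∞} (N : Submodule ℂ (Lp ℂ s (volume : Measure ℝ))) {G : ℝ → ℂ}
    (hG : ∀ᵐ x, G x ≠ 0) {n : ℕ} {φ : Fin n → ℝ → ℂ} (hφ : LinearIndependent ℂ φ)
    (hc : ∀ j, Continuous (φ j))
    (h1 : ∀ ψ ∈ N, ∃ κ ∈ Submodule.span ℂ (Set.range φ), (ψ : ℝ → ℂ) =ᵐ[volume] fun x => G x * κ x)
    (h2 : ∀ κ ∈ Submodule.span ℂ (Set.range φ), ∃ ψ ∈ N, (ψ : ℝ → ℂ) =ᵐ[volume] fun x => G x * κ x) :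
    Module.rank ℂ N = n := by
  have hcont : ∀ κ ∈ Submodule.span ℂ (Set.range φ), Continuous κ := fun κ hκ => by
    refine Submodule.span_induction (p := fun κ _ => Continuous κ) ?_ continuous_zero
      (fun _ _ _ _ => Continuous.add) (fun c _ _ h => h.const_smul c) hκ
    rintro _ ⟨j, rfl⟩
    exact hc j
  choose T hTN hT using h2
  let L : Submodule.span ℂ (Set.range φ) →ₗ[ℂ] N :=
    { toFun := fun κ => ⟨T κ κ.2, hTN κ κ.2⟩
      map_add' := fun a b => by
        refine Subtype.ext (Lp.ext ?_)
        filter_upwards [hT _ (a + b).2, hT _ a.2, hT _ b.2, Lp.coeFn_add (T _ a.2) (T _ b.2)] with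
          x e1 e2 e3 e4
        simp only [Submodule.coe_add] at e1 ⊢
        rw [e1, e4]
        simp only [Pi.add_apply, e2, e3, mul_add]
      map_smul' := fun c a => by
        refine Subtype.ext (Lp.ext ?_)
        filter_upwards [hT _ (c • a).2, hT _ a.2, Lp.coeFn_smul c (T _ a.2)] with x e1 e2 e3
        simp only [Submodule.coe_smul, RingHom.id_apply] at e1 ⊢
        rw [e1, e3]
        simp only [Pi.smul_apply, e2, smul_eq_mul, mul_left_comm] }
  have hinj : Function.Injective L := by
    rw [injective_iff_map_eq_zero]
    intro κ hκ
    have e0 : T κ κ.2 = 0 := congrArg Subtype.val hκ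
    have e1 := hT κ κ.2
    rw [e0] at e1
    refine Subtype.ext (((hcont κ κ.2).ae_eq_iff_eq volume continuous_zero).1 ?_)
    filter_upwards [e1, hG, Lp.coeFn_zero ℂ s (volume : Measure ℝ)] with x e2 e3 e4
    rw [e2] at e4
    exact (mul_eq_zero.1 e4).resolve_left e3
  have hsurj : Function.Surjective L := fun ψ => by
    obtain ⟨κ, hκ, e⟩ := h1 ψ ψ.2
    exact ⟨⟨κ, hκ⟩, Subtype.ext (Lp.ext ((hT κ hκ).trans e.symm))⟩
  rw [← (LinearEquiv.ofBijective L ⟨hinj, hsurj⟩).rank_eq, rank_span hφ,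
    Cardinal.mk_range_eq φ hφ.injective, Cardinal.mk_fin]

/-! ### The kernel of a Toeplitz operator with factored symbol -/

/-- Division by `x + i` brings a product back to `H_1^+`. -/
lemma MemHardyPlus.mul_mul_inv_add_I {a b : ℝ≥0∞} (ha : a ≠ ∞) (hab : a⁻¹ + b⁻¹ ≤ 1) {u v : ℝ → ℂ}
    (hu : MemHardyPlus a u) (hv : MemHardyPlus b v) :
    MemHardyPlus 1 (fun x : ℝ => u x * v x * ((x : ℂ) + I)⁻¹) := by
  set t : ℝ≥0∞ := (a⁻¹ + b⁻¹)⁻¹ with htdef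
  have : ENNReal.HolderTriple a b t := ⟨by rw [htdef, inv_inv]⟩
  have : Fact (1 ≤ t) := ⟨ENNReal.one_le_inv.2 hab⟩
  have htop : t ≠ ∞ := by
    rw [htdef, Ne, ENNReal.inv_eq_top, add_eq_zero, not_and_or]
    exact Or.inl (ENNReal.inv_ne_zero.2 ha)
  have h1 : 1 < ENNReal.conjExponent t :=
    (ENNReal.HolderConjugate.lt_top_iff_one_lt t (ENNReal.conjExponent t)).1 htop.lt_top
  exact (hu.mul hv (t := t)).mul (memHardyPlus_inv_add_I h1) (t := 1)

lemma MemHardyMinus.mul_mul_inv_sub_I {a b : ℝ≥0∞} (ha : a ≠ ∞) (hab : a⁻¹ + b⁻¹ ≤ 1)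
    {u v : ℝ → ℂ} (hu : MemHardyMinus a u) (hv : MemHardyMinus b v) :
    MemHardyMinus 1 (fun x : ℝ => u x * v x * ((x : ℂ) - I)⁻¹) := by
  rw [memHardyMinus_iff_conj]
  simpa using hu.conj_plus.mul_mul_inv_add_I ha hab hv.conj_plus

section Factorization

variable {q s : ℝ≥0∞} {g gm gp : ℝ → ℂ} {k : ℤ}

/-- The function `g_-ψ̄ / (x - i)²`, in `H_1^-` for `ψ ∈ H_s^+`. -/
lemma IsFactorization.memHardyMinus_one (hfac : IsFactorization q s g gm gp k) {ψ : ℝ → ℂ}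
    (hψ : MemHardyPlus s ψ) :
    MemHardyMinus 1 (fun x : ℝ => gm x * conj (ψ x) * ((x : ℂ) - I)⁻¹ ^ 2) := by
  refine (MemHardyMinus.mul_mul_inv_sub_I hfac.j_lt_top.ne hfac.inv_add_inv_le hfac.gm_mem
    hψ.conj_minus).congr (ae_of_all _ fun x => ?_)
  ring

/-- The function `g_+⁻¹gψ̄ / (x + i)²`, in `H_1^+` for `ḡψ ∈ H_s^-`. -/
lemma IsFactorization.memHardyPlus_one (hfac : IsFactorization q s g gm gp k) {ψ : ℝ → ℂ}
    (hψ : MemHardyMinus s (fun x => conj (g x) * ψ x)) :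
    MemHardyPlus 1 (fun x : ℝ => (gp x)⁻¹ * (g x * conj (ψ x)) * ((x : ℂ) + I)⁻¹ ^ 2) := by
  refine (MemHardyPlus.mul_mul_inv_add_I hfac.j_lt_top.ne hfac.inv_add_inv_le hfac.gp_inv_mem
    hψ.conj_plus).congr (ae_of_all _ fun x => ?_)
  simp only [map_mul, conj_conj]
  ring

lemma IsFactorization.toeplitzKer_eq_bot (hfac : IsFactorization q s g gm gp k) (hk : k < 0) :
    toeplitzKer s (fun x => conj (g x)) = ⊥ := by
  rw [eq_bot_iff]
  intro ψ hψ
  obtain ⟨h1, h2⟩ := mem_toeplitzKer_iff.1 hψ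
  obtain ⟨m, hm⟩ : ∃ m : ℕ, k = -((m : ℤ) + 1) := ⟨(-k - 1).toNat, by omega⟩
  have hA := ((memHardyMinus_rFun_inv_pow m).mul (hfac.memHardyMinus_one h1) (t := 1))
  obtain ⟨c, hc⟩ := exists_eq_sum_of_eq_rFun_pow_mul 1 hA (hfac.memHardyPlus_one h2) (by
    filter_upwards [hfac.eq, hfac.gp_ne] with x e1 e2
    have h0 := rFun_ne_zero x
    have e3 : rFun x ^ k = (rFun x)⁻¹ ^ m * (rFun x)⁻¹ := by
      rw [hm, zpow_neg, ← pow_succ, inv_pow]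
      norm_cast
    rw [e1, e3, inv_add_I_eq]
    field_simp)
  refine (Submodule.mem_bot ℂ).2 (Lp.ext ?_)
  filter_upwards [hc, hfac.eq, hfac.gp_ne, hfac.gm_ne, Lp.coeFn_zero ℂ s (volume : Measure ℝ)] with
    x e1 e2 e3 e4 e5
  rw [e5, Pi.zero_apply]
  have hr := zpow_ne_zero k (rFun_ne_zero x)
  have hI := ofReal_add_I_ne_zero x
  simpa [e2, e3, e4, hr, hI] using e1

/-- Elements of the kernel are multiples of `conj (g_-⁻¹)` by polynomials in `r` of degree at most
the index. -/
lemma IsFactorization.exists_rPowSpan {n : ℕ} (hfac : IsFactorization q s g gm gp n)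
    {ψ : Lp ℂ s (volume : Measure ℝ)} (hψ : ψ ∈ toeplitzKer s (fun x => conj (g x))) :
    ∃ κ ∈ rPowSpan n, (ψ : ℝ → ℂ) =ᵐ[volume] fun x => conj ((gm x)⁻¹) * κ x := by
  obtain ⟨h1, h2⟩ := mem_toeplitzKer_iff.1 hψ
  obtain ⟨c, hc⟩ := exists_eq_sum_of_eq_rFun_pow_mul (n + 2) (hfac.memHardyMinus_one h1)
    (hfac.memHardyPlus_one h2) (by
    filter_upwards [hfac.eq, hfac.gp_ne] with x e1 e2
    rw [e1, inv_add_I_eq, zpow_natCast, pow_add]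
    field_simp)
  refine ⟨∑ j ∈ Finset.range (n + 1), (conj (c j)) • fun x => 1 * rFun x ^ (n - j),
    Submodule.sum_mem _ fun j _ => Submodule.smul_mem _ _
      (Submodule.subset_span ⟨⟨n - j, by omega⟩, rfl⟩), ?_⟩
  filter_upwards [hc, hfac.eq, hfac.gp_ne, hfac.gm_ne] with x e1 e2 e3 e4
  have hI := ofReal_add_I_ne_zero x
  have hr := rFun_ne_zero x
  have e5 : gm x * rFun x ^ n * conj (ψ x) = ∑ j ∈ Finset.range (n + 1), c j * rFun x ^ j := by
    rw [e2, zpow_natCast] at e1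
    have e6 := mul_right_cancel₀ (pow_ne_zero 2 (inv_ne_zero hI)) e1
    rw [← Nat.add_sub_cancel (n := n + 1) (m := 1), ← e6]
    field_simp
  have e7 : conj (ψ x) = (gm x)⁻¹ * ∑ j ∈ Finset.range (n + 1), c j * (rFun x)⁻¹ ^ (n - j) := by
    have e8 : ∑ j ∈ Finset.range (n + 1), c j * (rFun x)⁻¹ ^ (n - j) =
        (rFun x ^ n)⁻¹ * ∑ j ∈ Finset.range (n + 1), c j * rFun x ^ j := by
      rw [Finset.mul_sum]
      refine Finset.sum_congr rfl fun j hj => ?_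
      have hjn : n = (n - j) + j := by have := Finset.mem_range.1 hj; omega
      nth_rewrite 2 [hjn]
      rw [pow_add, inv_pow]
      field_simp
    rw [e8, ← e5]
    field_simp
  have e9 := congrArg conj e7
  rw [conj_conj] at e9
  rw [e9, map_mul, map_sum]
  simp only [Finset.sum_apply, Pi.smul_apply, smul_eq_mul, one_mul, map_mul, map_pow, map_inv₀,
    conj_rFun, inv_inv]

lemma IsFactorization.ae_mul_conj {n : ℕ} (hfac : IsFactorization q s g gm gp n) (κ : ℝ → ℂ) :
    (fun x => conj (conj (g x) * (conj ((gm x)⁻¹) * κ x))) =ᵐ[volume]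
      fun x => gp x * (rFun x ^ n * conj (κ x)) := by
  filter_upwards [hfac.eq, hfac.gm_ne] with x e1 e2
  rw [e1]
  simp only [map_mul, conj_conj, zpow_natCast]
  field_simp

/-- A multiple of `conj (g_-⁻¹)` belongs to the kernel as soon as the multiplier `κ` satisfies the
two conditions of membership in the Hardy classes. -/
lemma IsFactorization.exists_mem_toeplitzKer {n : ℕ} (hfac : IsFactorization q s g gm gp n)
    {κ : ℝ → ℂ} (h1 : MemHardyPlus s (fun x => conj ((gm x)⁻¹) * κ x))
    (h2 : MemHardyPlus s (fun x => gp x * (rFun x ^ n * conj (κ x)))) :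
    ∃ ψ ∈ toeplitzKer s (fun x => conj (g x)),
      (ψ : ℝ → ℂ) =ᵐ[volume] fun x => conj ((gm x)⁻¹) * κ x := by
  have e := h1.1.coeFn_toLp
  refine ⟨h1.1.toLp _, mem_toeplitzKer_iff.2 ⟨h1.congr e.symm, ?_⟩, e⟩
  rw [memHardyMinus_iff_conj]
  refine h2.congr ?_
  filter_upwards [e, hfac.ae_mul_conj κ] with x e1 e2
  rw [e1, e2]

lemma IsFactorization.exists_mem_of_modelSpace {n : ℕ} (hfac : IsFactorization q s g gm gp n)
    {κ : ℝ → ℂ} (hκ : κ ∈ modelSpace n) :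
    ∃ ψ ∈ toeplitzKer s (fun x => conj (g x)),
      (ψ : ℝ → ℂ) =ᵐ[volume] fun x => conj ((gm x)⁻¹) * κ x :=
  hfac.exists_mem_toeplitzKer (hfac.gm_inv_mem.conj_plus.mul_mem hκ)
    (hfac.gp_mem.mul_mem (rFun_pow_mul_conj_mem_modelSpace hκ))

/-- An element of the kernel whose multiplier is not in `K_{r^n}` forces `g_-⁻¹ ∈ H_s^-` and
`g_+ ∈ H_s^+`. -/
lemma IsFactorization.exists_modelSpace {n : ℕ} (hfac : IsFactorization q s g gm gp n)
    (hne : ¬ MemHardyMinus s (fun x => (gm x)⁻¹) ∨ ¬ MemHardyPlus s gp)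
    {ψ : Lp ℂ s (volume : Measure ℝ)} (hψ : ψ ∈ toeplitzKer s (fun x => conj (g x))) :
    ∃ κ ∈ modelSpace n, (ψ : ℝ → ℂ) =ᵐ[volume] fun x => conj ((gm x)⁻¹) * κ x := by
  obtain ⟨κ, hκ, hψκ⟩ := hfac.exists_rPowSpan hψ
  obtain ⟨c, hc⟩ := exists_sub_const_mem_modelSpace hκ
  obtain ⟨h1, h2⟩ := mem_toeplitzKer_iff.1 hψ
  have hc0 : c = 0 := by
    by_contra hc0
    refine hne.elim (fun h => h ?_) (fun h => h ?_)
    · rw [memHardyMinus_iff_conj]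
      refine (((h1.congr hψκ).sub (hfac.gm_inv_mem.conj_plus.mul_mem hc)).const_mul c⁻¹).congr
        (ae_of_all _ fun x => ?_)
      field_simp
      ring
    · have h3 : MemHardyPlus s fun x => gp x * (rFun x ^ n * conj (κ x)) := by
        refine h2.conj_plus.congr ?_
        filter_upwards [hψκ, hfac.ae_mul_conj κ] with x e1 e2
        rw [e1, e2]
      have h4 := h3.sub (hfac.gp_mem.mul_mem (rFun_pow_mul_conj_mem_modelSpace hc))
      have h5 := (h4.const_mul (conj c)⁻¹).sub
        (hfac.gp_mem.mul_mem (rFun_pow_sub_one_mem_modelSpace (le_refl n)))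
      refine h5.congr (ae_of_all _ fun x => ?_)
      have hcc : conj c ≠ 0 := by simpa using hc0
      simp only [map_sub]
      field_simp
      ring
  subst hc0
  exact ⟨κ, by simpa using hc, hψκ⟩

lemma IsFactorization.exists_mem_of_rPowSpan {n : ℕ} (hfac : IsFactorization q s g gm gp n)
    (h1 : MemHardyMinus s (fun x => (gm x)⁻¹)) (h2 : MemHardyPlus s gp)
    {κ : ℝ → ℂ} (hκ : κ ∈ rPowSpan n) :
    ∃ ψ ∈ toeplitzKer s (fun x => conj (g x)),
      (ψ : ℝ → ℂ) =ᵐ[volume] fun x => conj ((gm x)⁻¹) * κ x := by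
  obtain ⟨c, hc⟩ := exists_sub_const_mem_modelSpace hκ
  refine hfac.exists_mem_toeplitzKer ?_ ?_
  · refine ((h1.conj_plus.const_mul c).add (hfac.gm_inv_mem.conj_plus.mul_mem hc)).congr
      (ae_of_all _ fun x => ?_)
    ring
  · have h3 : MemHardyPlus s fun x => gp x * rFun x ^ n :=
      h2.mul (memHardyPlus_rFun_pow n) (t := s)
    refine ((h3.const_mul (conj c)).add
      (hfac.gp_mem.mul_mem (rFun_pow_mul_conj_mem_modelSpace hc))).congr (ae_of_all _ fun x => ?_)
    simp only [map_sub]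
    ring

lemma IsFactorization.conj_inv_ne_zero (hfac : IsFactorization q s g gm gp k) :
    ∀ᵐ x, conj ((gm x)⁻¹) ≠ 0 := by
  filter_upwards [hfac.gm_ne] with x hx
  simpa using hx

lemma IsFactorization.rank_toeplitzKer {n : ℕ} (hfac : IsFactorization q s g gm gp n)
    (hne : ¬ MemHardyMinus s (fun x => (gm x)⁻¹) ∨ ¬ MemHardyPlus s gp) :
    Module.rank ℂ (toeplitzKer s (fun x => conj (g x))) = n := by
  refine rank_eq_of_multiples _ hfac.conj_inv_ne_zero
    (linearIndependent_mul_rFun_pow n (e := fun x => 1 / ((x : ℂ) + I))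
      fun x => one_div_ne_zero (ofReal_add_I_ne_zero x)) (fun j => ?_)
    (fun ψ hψ => hfac.exists_modelSpace hne hψ) (fun κ hκ => hfac.exists_mem_of_modelSpace hκ)
  exact (Continuous.div (by fun_prop) (by fun_prop) ofReal_add_I_ne_zero).mul
    (continuous_rFun.pow _)

lemma IsFactorization.rank_toeplitzKer_of_mem {n : ℕ} (hfac : IsFactorization q s g gm gp n)
    (h1 : MemHardyMinus s (fun x => (gm x)⁻¹)) (h2 : MemHardyPlus s gp) :
    Module.rank ℂ (toeplitzKer s (fun x => conj (g x))) = (n + 1 : ℕ) :=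
  rank_eq_of_multiples _ hfac.conj_inv_ne_zero
    (linearIndependent_mul_rFun_pow (n + 1) (e := fun _ => 1) fun _ => one_ne_zero)
    (fun _ => continuous_const.mul (continuous_rFun.pow _))
    (fun _ hψ => hfac.exists_rPowSpan hψ) (fun _ hκ => hfac.exists_mem_of_rPowSpan h1 h2 hκ)

/-- `g_-` and `g_-⁻¹` cannot be in `𝓗_p^-` and `H_{p'}^-`: their product would put `1/(x - i)` into
`H_1^-`. -/
lemma IsFactorization.not_memHardyMinus_inv {p p' : ℝ≥0∞} [ENNReal.HolderConjugate p p']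
    (hfac : IsFactorization q s g gm gp k) (hgm : MemScriptHardyMinus p gm) :
    ¬ MemHardyMinus p' (fun x => (gm x)⁻¹) := fun h => by
  have h1 : MemHardyMinus 1 fun x : ℝ => ((x : ℂ) - I)⁻¹ := by
    refine (MemHardyMinus.mul hgm h (t := 1)).congr ?_
    filter_upwards [hfac.gm_ne] with x hx
    field_simp
  have h2 : MemHardyPlus 1 fun x : ℝ => ((x : ℂ) + I)⁻¹ := by simpa using h1.conj_plus
  obtain ⟨c, hc⟩ := exists_eq_sum_of_eq_rFun_pow_mul 1 h1 h2
    (ae_of_all _ fun x => by simp only [pow_one, inv_add_I_eq])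
  obtain ⟨x, hx⟩ := hc.exists
  exact inv_ne_zero (ofReal_add_I_ne_zero x) (by simpa using hx)

end Factorization

theorem theorem7p2 (p p' q : ℝ≥0∞) [ENNReal.HolderConjugate p p']
    (hp : 1 < p) (hpq : p ≤ q) (hq : q < ∞)
    (g gm gp : ℝ → ℂ) (k : ℤ) (hg : MemLp g ∞ (volume : Measure ℝ))
    (hfac : IsFactorization q p' g gm gp k) :
    -- `ker T_g^* = ker T_ḡ`, with `T_ḡ` acting in `H_{p'}^+`
    toeplitzAdjointKer p p' g = toeplitzKer p' (fun x => conj (g x)) ∧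
    -- (i)
    (MemScriptHardyMinus p gm ∧ MemScriptHardyPlus p (fun x => (gp x)⁻¹) →
      (k ≤ 0 → Module.rank ℂ (toeplitzAdjointKer p p' g) = 0) ∧
      (0 < k →
        Module.rank ℂ (toeplitzAdjointKer p p' g) = (k.toNat : Cardinal) ∧
        -- `ker T_g^* = conj(g_-⁻¹) K_{r^k}`, as sets of functions modulo a.e. equality
        (fun ψ : Lp ℂ p' (volume : Measure ℝ) => (ψ : ℝ →ₘ[volume] ℂ)) ''
            (toeplitzAdjointKer p p' g : Set (Lp ℂ p' (volume : Measure ℝ))) =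
          {φ : ℝ →ₘ[volume] ℂ | ∃ κ ∈ modelSpace k.toNat,
            (φ : ℝ → ℂ) =ᵐ[volume] fun x => conj ((gm x)⁻¹) * κ x})) ∧
    -- (ii)
    (¬ MemScriptHardyMinus p gm ∨ ¬ MemScriptHardyPlus p (fun x => (gp x)⁻¹) →
      (k < 0 → Module.rank ℂ (toeplitzAdjointKer p p' g) = 0) ∧
      (0 ≤ k → ¬ MemHardyMinus p' (fun x => (gm x)⁻¹) ∨ ¬ MemHardyPlus p' gp →
        Module.rank ℂ (toeplitzAdjointKer p p' g) = (k.toNat : Cardinal)) ∧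
      (0 ≤ k → MemHardyMinus p' (fun x => (gm x)⁻¹) → MemHardyPlus p' gp →
        Module.rank ℂ (toeplitzAdjointKer p p' g) = (k.toNat : Cardinal) + 1)) := by
  have hker := toeplitzAdjointKer_eq (p' := p') hp (hpq.trans_lt hq).ne hg
  have hneg : k < 0 → Module.rank ℂ (toeplitzAdjointKer p p' g) = 0 := fun hk => by
    rw [hker, hfac.toeplitzKer_eq_bot hk, rank_bot]
  have hfac' : 0 ≤ k → IsFactorization q p' g gm gp (k.toNat : ℤ) := fun hk => by
    rwa [Int.toNat_of_nonneg hk]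
  refine ⟨hker, fun h => ⟨fun hk => ?_, fun hk => ⟨?_, ?_⟩⟩, fun _ => ⟨hneg, fun hk hne => ?_,
    fun hk h1 h2 => ?_⟩⟩
  · rcases hk.lt_or_eq with hk | rfl
    · exact hneg hk
    · rw [hker, (hfac' le_rfl).rank_toeplitzKer (Or.inl (hfac.not_memHardyMinus_inv h.1))]
      simp
  · rw [hker, (hfac' hk.le).rank_toeplitzKer (Or.inl (hfac.not_memHardyMinus_inv h.1))]
  · ext φ
    rw [hker]
    constructor
    · rintro ⟨ψ, hψ, rfl⟩
      exact (hfac' hk.le).exists_modelSpace (Or.inl (hfac.not_memHardyMinus_inv h.1)) hψ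
    · rintro ⟨κ, hκ, hφ⟩
      obtain ⟨ψ, hψ, e⟩ := (hfac' hk.le).exists_mem_of_modelSpace hκ
      exact ⟨ψ, hψ, AEEqFun.ext (e.trans hφ.symm)⟩
  · rw [hker, (hfac' hk).rank_toeplitzKer hne]
  · rw [hker, (hfac' hk).rank_toeplitzKer_of_mem h1 h2]
    push_cast
    rfl
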